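/- **Definitions.** An inverse semigroup is a semigroup in which every $a$ has a unique element $a^{-1}$ with $aa^{-1}a=a$ and $a^{-1}aa^{-1}=a^{-1}$; it is partially ordered by $a\le b \iff a=ba^{-1}a$. Let $S$ be an inverse semigroup with zero, and let $E(S)$ be its set of idempotents. Write $a\sim b$ (compatible) if $a^{-1}b$ and $ab^{-1}$ are idempotents, and $a\perp b$ (orthogonal) if $a^{-1}b=0=ab^{-1}$. For idempotents, $e\,\mathscr D\,f$ means that there is an $x$ with $x^{-1}x=e$ and $xx^{-1}=f$. $S$ is a *Boolean inverse semigroup* if any two compatible elements have a join, multiplication distributes over such joins on both sides, and $E(S)$ is a generalized Boolean algebra (a distributive lattice with bottom $0$ and relative complements). An *additive ideal* of $S$ is a non-empty subset $I$ with $SI\subseteq I$ and $IS\subseteq I$ such that $a\vee b\in I$ whenever $a,b\in I$ and $a\sim b$. $S$ is *$0$-simplifying* if $S\ne\{0\}$ and its only additive ideals are $\{0\}$ and $S$. $S$ is *semisimple* if $\{x\in S: x\le a\}$ is finite for every $a\in S$. Let $M_\omega(S)$ be the set of $\omega\times\omega$ matrices over $S$ with only finitely many non-zero entries such that $a^{-1}b=0$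 for entries $a,b$ in the same row and distinct columns, and $ab^{-1}=0$ for entries $a,b$ in the same column and distinct rows. With the product $(AB)_{ij}=\bigvee_k a_{ik}b_{kj}$ this is a Boolean inverse semigroup, in which any two idempotents $e,f$ have orthogonal idempotents $e'\,\mathscr D\,e$ and $f'\,\mathscr D\,f$. The *type monoid* of $S$ is the commutative monoid $\mathsf T(S)=E(M_\omega(S))/\mathscr D$ with addition $[e]+[f]=[e'\vee f']$, where $e'\,\mathscr D\,e$, $f'\,\mathscr D\,f$ and $e'\perp f'$, and with neutral element $[0]$. **Theorem.** Let $S$ be a Boolean inverse semigroup. Then the type monoid $\mathsf T(S)$ is isomorphic, as a monoid, to $(\mathbb N,+)$, where $\mathbb N=\{0,1,2,\dots\}$, if and only if $S$ is $0$-simplifying and semisimple. -/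

import Mathlib

set_option linter.unusedSectionVars false

/-- An inverse semigroup with zero: every `a` has exactly one `b` with `aba = a` and `bab = b`,
denoted `a⁻¹`. -/
class InverseSemigroupWithZero (S : Type*) extends SemigroupWithZero S, Inv S where
  mul_inv_mul_self : ∀ a : S, a * a⁻¹ * a = a
  inv_mul_inv_self : ∀ a : S, a⁻¹ * a * a⁻¹ = a⁻¹
  inv_unique : ∀ a b : S, a * b * a = a → b * a * b = b → b = a⁻¹

namespace InverseSemigroupWithZero

section Basic

variable {S : Type*} [InverseSemigroupWithZero S]

theorem mim (a : S) : a * (a⁻¹ * a) = a := by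
  rw [← mul_assoc, mul_inv_mul_self]

theorem imi (a : S) : a⁻¹ * (a * a⁻¹) = a⁻¹ := by
  rw [← mul_assoc, inv_mul_inv_self]

theorem inv_inv_self (a : S) : a⁻¹⁻¹ = a :=
  (inv_unique _ _ (inv_mul_inv_self a) (mul_inv_mul_self a)).symm

theorem inv_of_idem {e : S} (he : IsIdempotentElem e) : e⁻¹ = e :=
  (inv_unique _ _ (by rw [he.eq, he.eq]) (by rw [he.eq, he.eq])).symm

theorem inv_zero_eq : (0 : S)⁻¹ = 0 := inv_of_idem (by simp [IsIdempotentElem])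

theorem idem_inv_mul (a : S) : IsIdempotentElem (a⁻¹ * a) := by
  rw [IsIdempotentElem, ← mul_assoc, inv_mul_inv_self]

theorem idem_mul_inv (a : S) : IsIdempotentElem (a * a⁻¹) := by
  rw [IsIdempotentElem, ← mul_assoc, mul_inv_mul_self]

theorem idem_mul_aux {e f : S} (he : IsIdempotentElem e) (hf : IsIdempotentElem f) :
    IsIdempotentElem (e * f) := by
  have h1 := mul_inv_mul_self (e * f)
  have h2 := inv_mul_inv_self (e * f)
  set x := (e * f)⁻¹ with hx
  have h3 : f * x * e = x := by
    refine inv_unique _ _ ?_ ?_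
    · calc e * f * (f * x * e) * (e * f) = e * (f * f) * x * ((e * e) * f) := by
            simp only [mul_assoc]
        _ = e * f * x * (e * f) := by rw [he.eq, hf.eq]
        _ = e * f := h1
    · calc f * x * e * (e * f) * (f * x * e) = f * (x * ((e * e) * (f * f)) * x) * e := by
            simp only [mul_assoc]
        _ = f * (x * (e * f) * x) * e := by rw [he.eq, hf.eq]
        _ = f * x * e := by rw [h2]
  have h4 : IsIdempotentElem x := by
    rw [IsIdempotentElem]
    calc x * x = f * x * e * (f * x * e) := by rw [h3]
      _ = f * (x * (e * f) * x) * e := by simp only [mul_assoc]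
      _ = x := by rw [h2, h3]
  have h5 : e * f = x := by rw [← inv_inv_self (e * f), ← hx, inv_of_idem h4]
  rw [h5]; exact h4

theorem idem_comm {e f : S} (he : IsIdempotentElem e) (hf : IsIdempotentElem f) :
    e * f = f * e := by
  have h1 := idem_mul_aux he hf
  have h2 := idem_mul_aux hf he
  rw [← inv_of_idem h1]
  refine (inv_unique _ _ ?_ ?_).symm
  · calc e * f * (f * e) * (e * f) = e * (f * f) * ((e * e) * f) := by simp only [mul_assoc]
      _ = e * f := by rw [he.eq, hf.eq, h1.eq]
  · calc f * e * (e * f) * (f * e) = f * (e * e) * ((f * f) * e) := by simp only [mul_assoc]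
      _ = f * e := by rw [he.eq, hf.eq, h2.eq]

theorem idem_mul {e f : S} (he : IsIdempotentElem e) (hf : IsIdempotentElem f) :
    IsIdempotentElem (e * f) := idem_mul_aux he hf

theorem inv_mul_rev (a b : S) : (a * b)⁻¹ = b⁻¹ * a⁻¹ := by
  have hc := idem_comm (idem_inv_mul a) (idem_mul_inv b)
  refine (inv_unique _ _ ?_ ?_).symm
  · calc a * b * (b⁻¹ * a⁻¹) * (a * b) = a * ((b * b⁻¹) * (a⁻¹ * a)) * b := by
          simp only [mul_assoc]
      _ = (a * a⁻¹ * a) * (b * b⁻¹ * b) := by rw [← hc]; simp only [mul_assoc]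
      _ = a * b := by rw [mul_inv_mul_self, mul_inv_mul_self]
  · calc b⁻¹ * a⁻¹ * (a * b) * (b⁻¹ * a⁻¹) = b⁻¹ * ((a⁻¹ * a) * (b * b⁻¹)) * a⁻¹ := by
          simp only [mul_assoc]
      _ = (b⁻¹ * b * b⁻¹) * (a⁻¹ * a * a⁻¹) := by rw [hc]; simp only [mul_assoc]
      _ = b⁻¹ * a⁻¹ := by rw [inv_mul_inv_self, inv_mul_inv_self]

theorem idem_conj (a : S) {e : S} (he : IsIdempotentElem e) : IsIdempotentElem (a⁻¹ * e * a) := by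
  have hc := idem_comm he (idem_mul_inv a)
  calc a⁻¹ * e * a * (a⁻¹ * e * a) = a⁻¹ * (e * (a * a⁻¹)) * (e * a) := by simp only [mul_assoc]
    _ = a⁻¹ * a * a⁻¹ * (e * e) * a := by rw [hc]; simp only [mul_assoc]
    _ = a⁻¹ * e * a := by rw [he.eq, inv_mul_inv_self]

/-- `a e = (a e a⁻¹) a` for an idempotent `e`. -/
theorem mul_idem (a : S) {e : S} (he : IsIdempotentElem e) : a * e = a * e * a⁻¹ * a := by
  have hc := idem_comm he (idem_inv_mul a)
  calc a * e = a * (a⁻¹ * a) * e := by rw [mim]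
    _ = a * ((a⁻¹ * a) * e) := by simp only [mul_assoc]
    _ = a * e * a⁻¹ * a := by rw [← hc]; simp only [mul_assoc]

theorem idem_mul_eq (a : S) {e : S} (he : IsIdempotentElem e) : e * a = a * (a⁻¹ * e * a) := by
  have hc := idem_comm he (idem_mul_inv a)
  calc e * a = e * (a * a⁻¹ * a) := by rw [mul_inv_mul_self]
    _ = (e * (a * a⁻¹)) * a := by simp only [mul_assoc]
    _ = a * (a⁻¹ * e * a) := by rw [hc]; simp only [mul_assoc]

theorem eq_of_idem {a b e : S} (he : IsIdempotentElem e) (h : a = b * e) :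
    a = b * a⁻¹ * a := by
  have hc := idem_comm he (idem_inv_mul b)
  rw [h, inv_mul_rev, inv_of_idem he]
  calc b * e = b * (b⁻¹ * b) * (e * e) := by rw [mim, he.eq]
    _ = b * (((b⁻¹ * b) * e) * e) := by simp only [mul_assoc]
    _ = b * (e * b⁻¹) * (b * e) := by rw [← hc]; simp only [mul_assoc]

/-- The natural partial order: `a ≤ b` if and only if `a = b a⁻¹ a`. -/
instance naturalOrder : PartialOrder S where
  le a b := a = b * a⁻¹ * a
  le_refl a := (mul_inv_mul_self a).symm
  le_trans a b c hab hbc := by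
    have h : a = c * ((b⁻¹ * b) * (a⁻¹ * a)) := by
      calc a = b * a⁻¹ * a := hab
        _ = (c * b⁻¹ * b) * (a⁻¹ * a) := by rw [← hbc, mul_assoc]
        _ = _ := by simp only [mul_assoc]
    exact eq_of_idem (idem_mul (idem_inv_mul b) (idem_inv_mul a)) h
  le_antisymm a b hab hba := by
    have hab' : a = b * a⁻¹ * a := hab
    have hba' : b = a * b⁻¹ * b := hba
    calc a = b * a⁻¹ * a := hab'
      _ = (a * b⁻¹ * b) * a⁻¹ * a := by rw [← hba']
      _ = a * ((b⁻¹ * b) * (a⁻¹ * a)) := by simp only [mul_assoc]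
      _ = (a * a⁻¹ * a) * b⁻¹ * b := by
          rw [idem_comm (idem_inv_mul b) (idem_inv_mul a)]; simp only [mul_assoc]
      _ = b := by rw [mul_inv_mul_self, ← hba']

theorem le_def {a b : S} : a ≤ b ↔ a = b * a⁻¹ * a := Iff.rfl

theorem le_iff_right {a b : S} : a ≤ b ↔ ∃ e, IsIdempotentElem e ∧ a = b * e :=
  ⟨fun h => ⟨a⁻¹ * a, idem_inv_mul a, by rw [← mul_assoc]; exact h⟩,
    fun ⟨_, he, h⟩ => eq_of_idem he h⟩

theorem le_iff_left {a b : S} : a ≤ b ↔ ∃ e, IsIdempotentElem e ∧ a = e * b := by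
  rw [le_iff_right]
  constructor
  · rintro ⟨e, he, rfl⟩
    refine ⟨b * e * b⁻¹, ?_, mul_idem b he⟩
    have := idem_conj b⁻¹ he
    rwa [inv_inv_self] at this
  · rintro ⟨e, he, rfl⟩
    exact ⟨b⁻¹ * e * b, idem_conj b he, idem_mul_eq b he⟩

theorem zero_le_elem (a : S) : 0 ≤ a := by simp [le_def]

theorem le_zero_eq {a : S} (h : a ≤ 0) : a = 0 := le_antisymm h (zero_le_elem a)

theorem mul_le_left (s : S) {a b : S} (h : a ≤ b) : s * a ≤ s * b := by
  obtain ⟨e, he, rfl⟩ := le_iff_right.1 h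
  exact le_iff_right.2 ⟨e, he, by rw [mul_assoc]⟩

theorem mul_le_right (s : S) {a b : S} (h : a ≤ b) : a * s ≤ b * s := by
  obtain ⟨e, he, rfl⟩ := le_iff_left.1 h
  exact le_iff_left.2 ⟨e, he, by rw [mul_assoc]⟩

theorem inv_le {a b : S} (h : a ≤ b) : a⁻¹ ≤ b⁻¹ := by
  obtain ⟨e, he, rfl⟩ := le_iff_right.1 h
  exact le_iff_left.2 ⟨e, he, by rw [inv_mul_rev, inv_of_idem he]⟩

theorem idem_of_le {a e : S} (he : IsIdempotentElem e) (h : a ≤ e) : IsIdempotentElem a := by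
  obtain ⟨f, hf, rfl⟩ := le_iff_right.1 h
  exact idem_mul he hf

theorem inv_mul_le {e : S} (a b : S) (he : IsIdempotentElem e) : a * e * b ≤ a * b := by
  rw [mul_assoc]
  exact mul_le_left a (le_iff_left.2 ⟨e, he, rfl⟩)

theorem isLUB_inv {X : Set S} {c : S} (h : IsLUB X c) : IsLUB (Inv.inv '' X) c⁻¹ := by
  constructor
  · rintro _ ⟨x, hx, rfl⟩
    exact inv_le (h.1 hx)
  · intro d hd
    have : c ≤ d⁻¹ := h.2 fun x hx => by
      have := inv_le (hd ⟨x, hx, rfl⟩)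
      rwa [inv_inv_self] at this
    have := inv_le this
    rwa [inv_inv_self] at this

/-- The compatibility relation `a ∼ b`. -/
def Compatible (a b : S) : Prop := IsIdempotentElem (a⁻¹ * b) ∧ IsIdempotentElem (a * b⁻¹)

/-- The orthogonality relation `a ⟂ b`. -/
def Orthogonal (a b : S) : Prop := a⁻¹ * b = 0 ∧ a * b⁻¹ = 0

/-- The relation `𝒟`: some `x` satisfies `x⁻¹x = a⁻¹a` and `xx⁻¹ = b⁻¹b`. -/
def DRel (a b : S) : Prop := ∃ x : S, x⁻¹ * x = a⁻¹ * a ∧ x * x⁻¹ = b⁻¹ * b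

theorem Compatible.symm {a b : S} (h : Compatible a b) : Compatible b a := by
  constructor
  · have := inv_of_idem h.1
    rw [inv_mul_rev, inv_inv_self] at this
    rw [this]; exact h.1
  · have := inv_of_idem h.2
    rw [inv_mul_rev, inv_inv_self] at this
    rw [this]; exact h.2

theorem Compatible.refl (a : S) : Compatible a a := ⟨idem_inv_mul a, idem_mul_inv a⟩

theorem Orthogonal.compatible {a b : S} (h : Orthogonal a b) : Compatible a b := by
  constructor
  · rw [h.1]; simp [IsIdempotentElem]
  · rw [h.2]; simp [IsIdempotentElem]

theorem Orthogonal.symm {a b : S} (h : Orthogonal a b) : Orthogonal b a := by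
  constructor
  · rw [← inv_inv_self (b⁻¹ * a), inv_mul_rev, inv_inv_self, h.1, inv_zero_eq]
  · rw [← inv_inv_self (b * a⁻¹), inv_mul_rev, inv_inv_self, h.2, inv_zero_eq]

theorem Compatible.inv {a b : S} (h : Compatible a b) : Compatible a⁻¹ b⁻¹ := by
  constructor
  · rw [inv_inv_self]; exact h.2
  · rw [inv_inv_self]; exact h.1

theorem compatible_zero (a : S) : Compatible a 0 := by
  constructor <;> simp [IsIdempotentElem, inv_zero_eq]

theorem Compatible.of_idem {e f : S} (he : IsIdempotentElem e) (hf : IsIdempotentElem f) :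
    Compatible e f := by
  constructor
  · rw [inv_of_idem he]; exact idem_mul he hf
  · rw [inv_of_idem hf]; exact idem_mul he hf

theorem orthogonal_idem {e f : S} (he : IsIdempotentElem e) (hf : IsIdempotentElem f) :
    Orthogonal e f ↔ e * f = 0 := by
  rw [Orthogonal, inv_of_idem he, inv_of_idem hf, and_self]

theorem dRel_idem {e f : S} (he : IsIdempotentElem e) (hf : IsIdempotentElem f) :
    DRel e f ↔ ∃ x : S, x⁻¹ * x = e ∧ x * x⁻¹ = f := by
  rw [DRel, inv_of_idem he, inv_of_idem hf, he.eq, hf.eq]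

theorem dRel_refl (a : S) : DRel a a :=
  ⟨a⁻¹ * a, by rw [inv_of_idem (idem_inv_mul a), (idem_inv_mul a).eq],
    by rw [inv_of_idem (idem_inv_mul a), (idem_inv_mul a).eq]⟩

theorem DRel.symm {a b : S} : DRel a b → DRel b a := by
  rintro ⟨x, h1, h2⟩
  exact ⟨x⁻¹, by rw [inv_inv_self, h2], by rw [inv_inv_self, h1]⟩

theorem DRel.trans {a b c : S} : DRel a b → DRel b c → DRel a c := by
  rintro ⟨x, h1, h2⟩ ⟨y, h3, h4⟩
  refine ⟨y * x, ?_, ?_⟩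
  · calc (y * x)⁻¹ * (y * x) = x⁻¹ * (y⁻¹ * y) * x := by rw [inv_mul_rev]; simp only [mul_assoc]
      _ = (x⁻¹ * x * x⁻¹) * x := by rw [h3, ← h2]; simp only [mul_assoc]
      _ = a⁻¹ * a := by rw [inv_mul_inv_self, h1]
  · calc (y * x) * (y * x)⁻¹ = y * (x * x⁻¹) * y⁻¹ := by rw [inv_mul_rev]; simp only [mul_assoc]
      _ = (y * y⁻¹ * y) * y⁻¹ := by rw [h2, ← h3]; simp only [mul_assoc]
      _ = c⁻¹ * c := by rw [mul_inv_mul_self, h4]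

end Basic

/-- A semigroup with zero and an involution `a ↦ a⁻¹` satisfying `a a⁻¹ a = a`, in which the
elements `a a⁻¹` commute, is an inverse semigroup. -/
abbrev ofInvolution {S : Type*} [SemigroupWithZero S] [Inv S]
    (h1 : ∀ a : S, a * a⁻¹ * a = a) (h2 : ∀ a : S, a⁻¹⁻¹ = a)
    (h3 : ∀ a b : S, (a * b)⁻¹ = b⁻¹ * a⁻¹)
    (h4 : ∀ a b : S, a * a⁻¹ * (b * b⁻¹) = b * b⁻¹ * (a * a⁻¹)) :
    InverseSemigroupWithZero S where
  mul_inv_mul_self := h1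
  inv_mul_inv_self a := by simpa only [h2] using h1 a⁻¹
  inv_unique := by
    have key : ∀ e : S, e * e = e → e⁻¹ = e ∧ e * e⁻¹ = e := by
      intro e he
      have a1 : e = (e * e⁻¹) * (e⁻¹ * e) := by
        calc e = (e * e⁻¹ * e) * (e * e⁻¹ * e) := by rw [h1, he]
          _ = e * ((e⁻¹ * e) * (e * e⁻¹)) * e := by simp only [mul_assoc]
          _ = e * ((e * e⁻¹) * (e⁻¹ * e)) * e := by
              have := h4 e e⁻¹
              rw [h2] at this
              rw [this]
          _ = (e * e) * e⁻¹ * (e⁻¹ * (e * e)) := by simp only [mul_assoc]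
          _ = _ := by rw [he]
      have a2 : e⁻¹ = e := by
        calc e⁻¹ = ((e * e⁻¹) * (e⁻¹ * e))⁻¹ := by rw [← a1]
          _ = (e⁻¹ * e) * (e * e⁻¹) := by simp only [h3, h2]
          _ = (e * e⁻¹) * (e⁻¹ * e) := by
              have := h4 e e⁻¹
              rw [h2] at this
              rw [this]
          _ = e := a1.symm
      exact ⟨a2, by rw [a2, he]⟩
    intro a b hab hba
    have hi : ∀ a : S, a⁻¹ * a * a⁻¹ = a⁻¹ := fun a => by simpa only [h2] using h1 a⁻¹
    have comm : ∀ e f : S, e * e = e → f * f = f → e * f = f * e := by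
      intro e f he hf
      have := h4 e f
      rwa [(key e he).2, (key f hf).2] at this
    have c1 := comm (b * a) (a⁻¹ * a) (by rw [← mul_assoc, hba]) (by rw [← mul_assoc, hi])
    have c2 := comm (a * b) (a * a⁻¹) (by rw [← mul_assoc, hab]) (by rw [← mul_assoc, h1])
    have e1 : b * a = a⁻¹ * a := by
      calc b * a = b * (a * a⁻¹ * a) := by rw [h1]
        _ = b * a * (a⁻¹ * a) := by simp only [mul_assoc]
        _ = a⁻¹ * (a * b * a) := by rw [c1]; simp only [mul_assoc]
        _ = a⁻¹ * a := by rw [hab]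
    have e2 : a * b = a * a⁻¹ := by
      calc a * b = (a * a⁻¹ * a) * b := by rw [h1]
        _ = a * a⁻¹ * (a * b) := by simp only [mul_assoc]
        _ = (a * b * a) * a⁻¹ := by rw [← c2]; simp only [mul_assoc]
        _ = a * a⁻¹ := by rw [hab]
    calc b = b * a * b := hba.symm
      _ = a⁻¹ * (a * b) := by rw [e1, mul_assoc]
      _ = a⁻¹ := by rw [e2, ← mul_assoc, hi]

end InverseSemigroupWithZero

section BooleanInverse

open InverseSemigroupWithZero

/-- A Boolean inverse semigroup: compatible elements have joins for the natural partial order,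
multiplication distributes over these joins, and the idempotents form a (generalized) Boolean
algebra.  In the presence of the first three conditions the idempotents are an order ideal of `S`
and form a distributive lattice with bottom `0` and meet `e * f`, so the last condition amounts to
the existence of relative complements. -/
class BooleanInverseSemigroup (S : Type*) [InverseSemigroupWithZero S] : Prop where
  exists_join : ∀ a b : S, Compatible a b → ∃ c, IsLUB {a, b} c
  mul_join : ∀ s a b c : S, Compatible a b → IsLUB {a, b} c → IsLUB {s * a, s * b} (s * c)
  join_mul : ∀ s a b c : S, Compatible a b → IsLUB {a, b} c → IsLUB {a * s, b * s} (c * s)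
  exists_relative_complement : ∀ e f : S, IsIdempotentElem e → IsIdempotentElem f → e ≤ f →
    ∃ g, IsIdempotentElem g ∧ e * g = 0 ∧ IsLUB {e, g} f

namespace BooleanInverseSemigroup

variable {S : Type*} [InverseSemigroupWithZero S] [BooleanInverseSemigroup S]

theorem idem_join {e f c : S} (he : IsIdempotentElem e) (hf : IsIdempotentElem f)
    (h : IsLUB {e, f} c) : IsIdempotentElem c := by
  have hcomp := Compatible.of_idem he hf
  have hinv : c⁻¹ = c := by
    have := isLUB_inv h
    rw [Set.image_pair, inv_of_idem he, inv_of_idem hf] at this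
    exact this.unique h
  have h1 : e ≤ c := h.1 (by simp)
  have h2 : f ≤ c := h.1 (by simp)
  have h3 : c * e = e := by
    have := le_def.1 h1
    rw [inv_of_idem he, mul_assoc, he.eq] at this
    exact this.symm
  have h4 : c * f = f := by
    have := le_def.1 h2
    rw [inv_of_idem hf, mul_assoc, hf.eq] at this
    exact this.symm
  have := mul_join c e f c hcomp h
  rw [h3, h4] at this
  exact this.unique h

theorem compatible_join {a b c d : S} (hab : Compatible a b) (h : IsLUB {a, b} c)
    (ha : Compatible d a) (hb : Compatible d b) : Compatible d c := by
  constructor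
  · exact idem_join ha.1 hb.1 (mul_join d⁻¹ a b c hab h)
  · have h' := isLUB_inv h
    rw [Set.image_pair] at h'
    exact idem_join ha.2 hb.2 (mul_join d _ _ _ hab.inv h')

theorem orthogonal_join {a b c d : S} (hab : Compatible a b) (h : IsLUB {a, b} c)
    (ha : Orthogonal d a) (hb : Orthogonal d b) : Orthogonal d c := by
  constructor
  · have := mul_join d⁻¹ a b c hab h
    rw [ha.1, hb.1] at this
    exact le_zero_eq (this.2 (by simp [upperBounds]))
  · have h' := isLUB_inv h
    rw [Set.image_pair] at h'
    have := mul_join d _ _ _ hab.inv h'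
    rw [ha.2, hb.2] at this
    exact le_zero_eq (this.2 (by simp [upperBounds]))

theorem isLUB_insert_zero {X : Set S} {c : S} : IsLUB (insert 0 X) c ↔ IsLUB X c := by
  have : upperBounds (insert 0 X) = upperBounds X := by
    ext y
    simp [upperBounds, zero_le_elem]
  rw [IsLUB, this, ← IsLUB]

theorem exists_finset_join {ι : Type*} (f : ι → S) (s : Finset ι)
    (hf : ∀ i ∈ s, ∀ j ∈ s, Compatible (f i) (f j)) :
    ∃ c, IsLUB (f '' s) c ∧ (∀ d, IsLUB ((fun i => d * f i) '' s) (d * c)) ∧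
      (∀ d, IsLUB ((fun i => f i * d) '' s) (c * d)) ∧
      ∀ d, (∀ i ∈ s, Compatible d (f i)) → Compatible d c := by
  classical
  induction s using Finset.induction_on with
  | empty =>
    refine ⟨0, ?_, ?_, ?_, fun d _ => compatible_zero d⟩ <;>
      simp [IsLUB, upperBounds, IsLeast, lowerBounds, zero_le_elem]
  | insert a s ha ih =>
    obtain ⟨c, hc, hl, hr, hd⟩ := ih fun i hi j hj =>
      hf i (Finset.mem_insert_of_mem hi) j (Finset.mem_insert_of_mem hj)
    have hac : Compatible (f a) c := hd _ fun i hi =>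
      hf a (Finset.mem_insert_self _ _) i (Finset.mem_insert_of_mem hi)
    obtain ⟨e, he⟩ := exists_join _ _ hac
    have key : ∀ (g : ι → S) (x y : S), IsLUB (g '' s) x → IsLUB {g a, x} y →
        IsLUB (g '' (insert a s : Finset ι)) y := by
      intro g x y hx hy
      rw [Finset.coe_insert, Set.image_insert_eq]
      have hu : upperBounds (insert (g a) (g '' s)) = upperBounds {g a, x} := by
        ext z
        have : z ∈ upperBounds (g '' s) ↔ x ≤ z := (isLUB_le_iff hx).symm
        rw [upperBounds_insert, upperBounds_insert]
        simp only [Set.mem_inter_iff, this, upperBounds_singleton]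
        rfl
      rw [IsLUB, hu]; exact hy
    refine ⟨e, key f c e hc he, fun d => key _ _ _ (hl d) (mul_join d _ _ _ hac he),
      fun d => key _ _ _ (hr d) (join_mul d _ _ _ hac he), fun d hdd => ?_⟩
    exact compatible_join hac he (hdd a (Finset.mem_insert_self _ _))
      (hd d fun i hi => hdd i (Finset.mem_insert_of_mem hi))

/-- A finitely supported family of pairwise compatible elements has a join, and multiplication
distributes over it. -/
theorem exists_finite_join {ι : Type*} (f : ι → S) (hfin : {i | f i ≠ 0}.Finite)
    (hf : ∀ i j, Compatible (f i) (f j)) :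
    ∃ c, IsLUB (Set.range f) c ∧ (∀ d, IsLUB (Set.range fun i => d * f i) (d * c)) ∧
      (∀ d, IsLUB (Set.range fun i => f i * d) (c * d)) := by
  obtain ⟨c, hc, hl, hr, -⟩ := exists_finset_join f hfin.toFinset fun i _ j _ => hf i j
  have key : ∀ (g : ι → S) (x : S), (∀ i, f i = 0 → g i = 0) →
      IsLUB (g '' hfin.toFinset) x → IsLUB (Set.range g) x := by
    intro g x hg hx
    rw [← isLUB_insert_zero] at hx ⊢
    have : insert 0 (Set.range g) = insert 0 (g '' hfin.toFinset) := by
      ext y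
      simp only [Set.mem_insert_iff, Set.mem_range, Set.mem_image, Set.Finite.coe_toFinset,
        Set.mem_ofPred_eq]
      constructor
      · rintro (rfl | ⟨i, rfl⟩)
        · exact Or.inl rfl
        · by_cases h : f i = 0
          · exact Or.inl (hg i h)
          · exact Or.inr ⟨i, h, rfl⟩
      · rintro (rfl | ⟨i, -, rfl⟩)
        · exact Or.inl rfl
        · exact Or.inr ⟨i, rfl⟩
    rw [this]; exact hx
  exact ⟨c, key _ _ (fun _ h => h) hc, fun d => key _ _ (fun i h => by simp [h]) (hl d),
    fun d => key _ _ (fun i h => by simp [h]) (hr d)⟩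

theorem mul_isLUB {ι : Type*} {f : ι → S} (hfin : {i | f i ≠ 0}.Finite)
    (hf : ∀ i j, Compatible (f i) (f j)) {c : S} (hc : IsLUB (Set.range f) c) (d : S) :
    IsLUB (Set.range fun i => d * f i) (d * c) := by
  obtain ⟨c', h1, h2, -⟩ := exists_finite_join f hfin hf
  rw [hc.unique h1]; exact h2 d

theorem isLUB_mul {ι : Type*} {f : ι → S} (hfin : {i | f i ≠ 0}.Finite)
    (hf : ∀ i j, Compatible (f i) (f j)) {c : S} (hc : IsLUB (Set.range f) c) (d : S) :
    IsLUB (Set.range fun i => f i * d) (c * d) := by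
  obtain ⟨c', h1, -, h2⟩ := exists_finite_join f hfin hf
  rw [hc.unique h1]; exact h2 d

theorem isLUB_range_single {ι : Type*} {f : ι → S} (i : ι) (hf : ∀ j, j ≠ i → f j = 0) :
    IsLUB (Set.range f) (f i) := by
  constructor
  · rintro _ ⟨j, rfl⟩
    by_cases h : j = i
    · rw [h]
    · rw [hf j h]; exact zero_le_elem _
  · intro y hy
    exact hy ⟨i, rfl⟩

theorem isLUB_range_zero {ι : Type*} {f : ι → S} (hf : ∀ j, f j = 0) :
    IsLUB (Set.range f) 0 := by
  constructor
  · rintro _ ⟨j, rfl⟩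
    rw [hf j]
  · intro y _
    exact zero_le_elem _

end BooleanInverseSemigroup

/-- An additive ideal: a (non-empty) semigroup ideal closed under joins of compatible elements. -/
structure IsAdditiveIdeal {S : Type*} [InverseSemigroupWithZero S] (I : Set S) : Prop where
  zero_mem : (0 : S) ∈ I
  mul_mem_left : ∀ s a : S, a ∈ I → s * a ∈ I
  mul_mem_right : ∀ s a : S, a ∈ I → a * s ∈ I
  join_mem : ∀ a b c : S, a ∈ I → b ∈ I → Compatible a b → IsLUB {a, b} c → c ∈ I

/-- `S` is `0`-simplifying: `S ≠ {0}` and its only additive ideals are `{0}` and `S`. -/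
def IsZeroSimplifying (S : Type*) [InverseSemigroupWithZero S] : Prop :=
  Nontrivial S ∧ ∀ I : Set S, IsAdditiveIdeal I → I = {0} ∨ I = Set.univ

/-- `S` is semisimple: every principal order ideal `{x | x ≤ a}` is finite. -/
def IsSemisimpleInverse (S : Type*) [InverseSemigroupWithZero S] : Prop :=
  ∀ a : S, (Set.Iic a).Finite

section Classes

/-- The idempotents of `T`. -/
abbrev Idempotents (T : Type*) [InverseSemigroupWithZero T] : Type _ :=
  {e : T // IsIdempotentElem e}

/-- `𝒟`-equivalence of idempotents. -/
def idempotentSetoid (T : Type*) [InverseSemigroupWithZero T] : Setoid (Idempotents T) where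
  r e f := DRel e.1 f.1
  iseqv := ⟨fun e => dRel_refl e.1, DRel.symm, DRel.trans⟩

/-- The set `E(T)/𝒟` of `𝒟`-classes of idempotents. -/
def IdempotentClasses (T : Type*) [InverseSemigroupWithZero T] : Type _ :=
  Quotient (idempotentSetoid T)

/-- `T` is orthogonally separating: any two idempotents have orthogonal `𝒟`-related copies. -/
class OrthogonallySeparating (T : Type*) [InverseSemigroupWithZero T] : Prop where
  exists_orthogonal : ∀ e f : Idempotents T, ∃ e' f' : Idempotents T,
    DRel e'.1 e.1 ∧ DRel f'.1 f.1 ∧ Orthogonal e'.1 f'.1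

variable {T : Type*} [InverseSemigroupWithZero T] [BooleanInverseSemigroup T]

open BooleanInverseSemigroup

theorem exists_idempotent_join (e f : Idempotents T) :
    ∃ g : Idempotents T, IsLUB {e.1, f.1} g.1 := by
  obtain ⟨c, hc⟩ := exists_join e.1 f.1 (Compatible.of_idem e.2 f.2)
  exact ⟨⟨c, idem_join e.2 f.2 hc⟩, hc⟩

theorem dRel_join_aux {a b c e f g : T} (hab : Orthogonal a b) (hc : IsLUB {a, b} c)
    (ha : a⁻¹ * a = e) (hb : b⁻¹ * b = f) (hg : IsLUB {e, f} g) : c⁻¹ * c = g := by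
  have h1 : c⁻¹ * a = e := by
    have := isLUB_inv hc
    rw [Set.image_pair] at this
    have := join_mul a _ _ _ hab.compatible.inv this
    rw [ha, hab.symm.1, Set.pair_comm] at this
    exact (isLUB_insert_zero.1 this).unique isLUB_singleton
  have h2 : c⁻¹ * b = f := by
    have := isLUB_inv hc
    rw [Set.image_pair] at this
    have := join_mul b _ _ _ hab.compatible.inv this
    rw [hb, hab.1] at this
    exact (isLUB_insert_zero.1 this).unique isLUB_singleton
  have := mul_join c⁻¹ _ _ _ hab.compatible hc
  rw [h1, h2] at this
  exact this.unique hg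

theorem dRel_join {e f g e' f' g' : Idempotents T} (he : DRel e.1 e'.1) (hf : DRel f.1 f'.1)
    (hef : Orthogonal e.1 f.1) (hef' : Orthogonal e'.1 f'.1)
    (hg : IsLUB {e.1, f.1} g.1) (hg' : IsLUB {e'.1, f'.1} g'.1) : DRel g.1 g'.1 := by
  rw [dRel_idem e.2 e'.2] at he
  rw [dRel_idem f.2 f'.2] at hf
  rw [dRel_idem g.2 g'.2]
  rw [orthogonal_idem e.2 f.2] at hef
  rw [orthogonal_idem e'.2 f'.2] at hef'
  obtain ⟨a, ha1, ha2⟩ := he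
  obtain ⟨b, hb1, hb2⟩ := hf
  have hab : Orthogonal a b := by
    constructor
    · calc a⁻¹ * b = a⁻¹ * (a * a⁻¹) * (b * b⁻¹ * b) := by rw [imi, mul_inv_mul_self]
        _ = a⁻¹ * ((a * a⁻¹) * (b * b⁻¹)) * b := by simp only [mul_assoc]
        _ = 0 := by rw [ha2, hb2, hef', mul_zero, zero_mul]
    · calc a * b⁻¹ = a * (a⁻¹ * a) * (b⁻¹ * b * b⁻¹) := by rw [mim, inv_mul_inv_self]
        _ = a * ((a⁻¹ * a) * (b⁻¹ * b)) * b⁻¹ := by simp only [mul_assoc]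
        _ = 0 := by rw [ha1, hb1, hef, mul_zero, zero_mul]
  obtain ⟨c, hc⟩ := exists_join a b hab.compatible
  refine ⟨c, dRel_join_aux hab hc ha1 hb1 hg, ?_⟩
  have hab' : Orthogonal a⁻¹ b⁻¹ := by
    constructor
    · rw [inv_inv_self]; exact hab.2
    · rw [inv_inv_self]; exact hab.1
  have hc' := isLUB_inv hc
  rw [Set.image_pair] at hc'
  have := dRel_join_aux hab' hc' (by rw [inv_inv_self, ha2]) (by rw [inv_inv_self, hb2]) hg'
  rwa [inv_inv_self] at this

/-- `[e] + [f] = [g]`: there are `e' 𝒟 e` and `f' 𝒟 f` with `e' ⟂ f'` and `g 𝒟 e' ∨ f'`. -/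
def IsClassSum (x y z : IdempotentClasses T) : Prop :=
  ∃ e f g : Idempotents T, Orthogonal e.1 f.1 ∧ IsLUB {e.1, f.1} g.1 ∧
    x = Quotient.mk (idempotentSetoid T) e ∧ y = Quotient.mk (idempotentSetoid T) f ∧
    z = Quotient.mk (idempotentSetoid T) g

theorem exists_classSum [OrthogonallySeparating T] (x y : IdempotentClasses T) :
    ∃ z, IsClassSum x y z := by
  induction x using Quotient.inductionOn with | _ e
  induction y using Quotient.inductionOn with | _ f
  obtain ⟨e', f', he, hf, h⟩ := OrthogonallySeparating.exists_orthogonal e f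
  obtain ⟨g, hg⟩ := exists_idempotent_join e' f'
  exact ⟨_, e', f', g, h, hg, Quotient.sound (DRel.symm he), Quotient.sound (DRel.symm hf), rfl⟩

theorem IsClassSum.unique {x y z z' : IdempotentClasses T} :
    IsClassSum x y z → IsClassSum x y z' → z = z' := by
  rintro ⟨e, f, g, h, hg, rfl, rfl, rfl⟩ ⟨e', f', g', h', hg', he, hf, rfl⟩
  exact Quotient.sound (dRel_join (Quotient.exact he) (Quotient.exact hf) h h' hg hg')

theorem IsClassSum.symm {x y z : IdempotentClasses T} : IsClassSum x y z → IsClassSum y x z := by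
  rintro ⟨e, f, g, h, hg, rfl, rfl, rfl⟩
  exact ⟨f, e, g, h.symm, by rwa [Set.pair_comm], rfl, rfl, rfl⟩

theorem isClassSum_zero (x : IdempotentClasses T) :
    IsClassSum (Quotient.mk (idempotentSetoid T) ⟨0, by simp [IsIdempotentElem]⟩) x x := by
  induction x using Quotient.inductionOn with | _ e
  exact ⟨_, e, e, by constructor <;> simp [inv_zero_eq],
    isLUB_insert_zero.2 isLUB_singleton, rfl, rfl, rfl⟩

theorem IsClassSum.assoc [OrthogonallySeparating T] {x y z u v : IdempotentClasses T}
    (hu : IsClassSum x y u) (hv : IsClassSum u z v) :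
    ∃ w, IsClassSum y z w ∧ IsClassSum x w v := by
  obtain ⟨e, f, g, hef, hg, rfl, rfl, rfl⟩ := hu
  obtain ⟨g', k, m, hgk, hm, hgg, rfl, rfl⟩ := hv
  obtain ⟨a, ha1, ha2⟩ := (dRel_idem g.2 g'.2).1 (Quotient.exact hgg)
  have hcomp := Compatible.of_idem e.2 f.2
  have heg : e.1 ≤ g.1 := hg.1 (by simp)
  have hfg : f.1 ≤ g.1 := hg.1 (by simp)
  -- transport `e` and `f` below `g'`
  have tr : ∀ p : Idempotents T, p.1 ≤ g.1 → ∃ q : Idempotents T, q.1 = a * p.1 * a⁻¹ ∧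
      DRel p.1 q.1 := by
    intro p hp
    have hq : IsIdempotentElem (a * p.1 * a⁻¹) := by
      have := idem_conj a⁻¹ p.2
      rwa [inv_inv_self] at this
    refine ⟨⟨_, hq⟩, rfl, (dRel_idem p.2 hq).2 ⟨a * p.1, ?_, ?_⟩⟩
    · have hp' : p.1 = g.1 * p.1 := by
        have := le_def.1 hp
        rwa [inv_of_idem p.2, mul_assoc, p.2.eq] at this
      rw [inv_mul_rev, inv_of_idem p.2]
      calc p.1 * a⁻¹ * (a * p.1) = p.1 * ((a⁻¹ * a) * p.1) := by simp only [mul_assoc]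
        _ = p.1 := by rw [ha1, ← hp', p.2.eq]
    · rw [inv_mul_rev, inv_of_idem p.2]
      calc a * p.1 * (p.1 * a⁻¹) = a * (p.1 * p.1) * a⁻¹ := by simp only [mul_assoc]
        _ = a * p.1 * a⁻¹ := by rw [p.2.eq]
  obtain ⟨e', he', hee⟩ := tr e heg
  obtain ⟨f', hf', hff⟩ := tr f hfg
  have hLUB : IsLUB {e'.1, f'.1} g'.1 := by
    have h1 := mul_join a _ _ _ hcomp hg
    have hc2 : Compatible (a * e.1) (a * f.1) := by
      rw [orthogonal_idem e.2 f.2] at hef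
      have hef2 : f.1 * e.1 = 0 := by rw [idem_comm f.2 e.2, hef]
      constructor
      · have : (a * e.1)⁻¹ * (a * f.1) = 0 := by
          rw [inv_mul_rev, inv_of_idem e.2]
          calc e.1 * a⁻¹ * (a * f.1) = e.1 * ((a⁻¹ * a) * f.1) := by simp only [mul_assoc]
            _ = (e.1 * f.1) * (a⁻¹ * a) := by
              rw [idem_comm (idem_inv_mul a) f.2, mul_assoc]
            _ = 0 := by rw [hef, zero_mul]
        rw [this]; simp [IsIdempotentElem]
      · have : (a * e.1) * (a * f.1)⁻¹ = 0 := by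
          rw [inv_mul_rev, inv_of_idem f.2]
          calc a * e.1 * (f.1 * a⁻¹) = a * (e.1 * f.1) * a⁻¹ := by simp only [mul_assoc]
            _ = 0 := by rw [hef, mul_zero, zero_mul]
        rw [this]; simp [IsIdempotentElem]
    have h2 := join_mul a⁻¹ _ _ _ hc2 h1
    have h3 : a * g.1 * a⁻¹ = g'.1 := by
      rw [← ha1, mim, ha2]
    rwa [h3, ← he', ← hf'] at h2
  have hg'k := (orthogonal_idem g'.2 k.2).1 hgk
  have below : ∀ p : Idempotents T, p.1 ≤ g'.1 → Orthogonal p.1 k.1 := by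
    intro p hp
    rw [orthogonal_idem p.2 k.2]
    have := mul_le_right k.1 hp
    rw [hg'k] at this
    exact le_zero_eq this
  have hek := below e' (hLUB.1 (by simp))
  have hfk := below f' (hLUB.1 (by simp))
  have hef' : Orthogonal e'.1 f'.1 := by
    rw [orthogonal_idem e'.2 f'.2, he', hf']
    rw [orthogonal_idem e.2 f.2] at hef
    calc a * e.1 * a⁻¹ * (a * f.1 * a⁻¹) = a * (e.1 * ((a⁻¹ * a) * f.1)) * a⁻¹ := by
          simp only [mul_assoc]
      _ = a * ((e.1 * f.1) * (a⁻¹ * a)) * a⁻¹ := by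
          rw [idem_comm (idem_inv_mul a) f.2, mul_assoc e.1]
      _ = 0 := by rw [hef, zero_mul, mul_zero, zero_mul]
  obtain ⟨w, hw⟩ := exists_idempotent_join f' k
  refine ⟨_, ⟨f', k, w, hfk, hw, Quotient.sound hff, rfl, rfl⟩, e', w, m, ?_, ?_,
    Quotient.sound hee, rfl, rfl⟩
  · exact orthogonal_join (Compatible.of_idem f'.2 k.2) hw hef' hek
  · have hu : upperBounds {e'.1, w.1} = upperBounds {g'.1, k.1} := by
      ext z
      have h1 : g'.1 ≤ z ↔ e'.1 ≤ z ∧ f'.1 ≤ z := by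
        rw [isLUB_le_iff hLUB]; simp [upperBounds]
      have h2 : w.1 ≤ z ↔ f'.1 ≤ z ∧ k.1 ≤ z := by
        rw [isLUB_le_iff hw]; simp [upperBounds]
      simp only [upperBounds, Set.mem_insert_iff, Set.mem_singleton_iff, forall_eq_or_imp,
        forall_eq, Set.mem_ofPred_eq, h1, h2, and_assoc]
    rw [IsLUB, hu]; exact hm

noncomputable instance IdempotentClasses.instAdd [OrthogonallySeparating T] :
    Add (IdempotentClasses T) where
  add x y := (exists_classSum x y).choose

instance IdempotentClasses.instZero : Zero (IdempotentClasses T) where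
  zero := Quotient.mk (idempotentSetoid T) ⟨0, by simp [IsIdempotentElem]⟩

/-- The defining property of addition. -/
theorem isClassSum_add [OrthogonallySeparating T] (x y : IdempotentClasses T) :
    IsClassSum x y (x + y) := (exists_classSum x y).choose_spec

/-- The commutative monoid `E(T)/𝒟` of an orthogonally separating Boolean inverse semigroup:
`[e] + [f] = [e' ∨ f']`, where `e' 𝒟 e`, `f' 𝒟 f` and `e' ⟂ f'`, with neutral element `[0]`. -/
noncomputable instance IdempotentClasses.instAddCommMonoid [OrthogonallySeparating T] :
    AddCommMonoid (IdempotentClasses T) where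
  add_assoc x y z := by
    obtain ⟨w, hw, hv⟩ := (isClassSum_add x y).assoc (isClassSum_add (x + y) z)
    have h1 : w = y + z := hw.unique (isClassSum_add y z)
    subst h1
    exact hv.unique (isClassSum_add x _)
  zero_add x := (isClassSum_add 0 x).unique (isClassSum_zero x)
  add_zero x := (isClassSum_add x 0).unique (isClassSum_zero x).symm
  add_comm x y := (isClassSum_add x y).unique (isClassSum_add y x).symm
  nsmul := nsmulRec

end Classes

section RookMatrices

open BooleanInverseSemigroup

/-- Generalized rook matrices over `S`, with rows and columns indexed by `ι`: distinct entries of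
a row satisfy `a⁻¹b = 0`, distinct entries of a column satisfy `ab⁻¹ = 0`, and only finitely many
entries are non-zero. -/
@[ext]
structure RookMatrix (ι S : Type*) [InverseSemigroupWithZero S] where
  entry : ι → ι → S
  row : ∀ i j j', j ≠ j' → (entry i j)⁻¹ * entry i j' = 0
  col : ∀ i i' j, i ≠ i' → entry i j * (entry i' j)⁻¹ = 0
  finite : {p : ι × ι | entry p.1 p.2 ≠ 0}.Finite

namespace RookMatrix

variable {ι S : Type*} [InverseSemigroupWithZero S]

instance : Zero (RookMatrix ι S) where
  zero := ⟨fun _ _ => 0, by simp, by simp, by simp⟩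

/-- `A⁻¹` is the transpose of the matrix of inverses. -/
instance : Inv (RookMatrix ι S) where
  inv A :=
    { entry := fun i j => (A.entry j i)⁻¹
      row := fun i j j' h => by rw [inv_inv_self]; exact A.col j j' i h
      col := fun i i' j h => by rw [inv_inv_self]; exact A.row j i i' h
      finite := by
        refine (A.finite.image Prod.swap).subset ?_
        rintro ⟨i, j⟩ h
        refine ⟨(j, i), ?_, rfl⟩
        intro h0
        apply h
        change (A.entry j i)⁻¹ = 0
        have h0 : A.entry j i = 0 := h0
        rw [h0, inv_zero_eq] }

@[simp] theorem zero_entry (i j : ι) : (0 : RookMatrix ι S).entry i j = 0 := rfl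

@[simp] theorem inv_entry (A : RookMatrix ι S) (i j : ι) : A⁻¹.entry i j = (A.entry j i)⁻¹ := rfl

theorem finite_row (A : RookMatrix ι S) (i : ι) : {j | A.entry i j ≠ 0}.Finite :=
  (A.finite.image Prod.snd).subset fun j hj => ⟨(i, j), hj, rfl⟩

theorem finite_col (A : RookMatrix ι S) (j : ι) : {i | A.entry i j ≠ 0}.Finite :=
  (A.finite.image Prod.fst).subset fun i hi => ⟨(i, j), hi, rfl⟩

theorem finite_diag (A : RookMatrix ι S) : {i | A.entry i i ≠ 0}.Finite :=
  (A.finite.image Prod.fst).subset fun i hi => ⟨(i, i), hi, rfl⟩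

theorem terms_finite (A B : RookMatrix ι S) (i j : ι) :
    {k | A.entry i k * B.entry k j ≠ 0}.Finite :=
  (A.finite_row i).subset fun k hk h => hk (by
    have h : A.entry i k = 0 := h
    simp [h])

theorem terms_orthogonal (A B : RookMatrix ι S) (i j : ι) {k l : ι} (h : k ≠ l) :
    Orthogonal (A.entry i k * B.entry k j) (A.entry i l * B.entry l j) := by
  constructor
  · rw [inv_mul_rev]
    calc _ = (B.entry k j)⁻¹ * ((A.entry i k)⁻¹ * A.entry i l) * B.entry l j := by
          simp only [mul_assoc]
      _ = 0 := by rw [A.row i k l h, mul_zero, zero_mul]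
  · rw [inv_mul_rev]
    calc _ = A.entry i k * (B.entry k j * (B.entry l j)⁻¹) * (A.entry i l)⁻¹ := by
          simp only [mul_assoc]
      _ = 0 := by rw [B.col k l j h, mul_zero, zero_mul]

theorem terms_compatible (A B : RookMatrix ι S) (i j k l : ι) :
    Compatible (A.entry i k * B.entry k j) (A.entry i l * B.entry l j) := by
  by_cases h : k = l
  · subst h; exact Compatible.refl _
  · exact (terms_orthogonal A B i j h).compatible

theorem isLUB_inv_range {κ : Type*} {f : κ → S} {c : S} (h : IsLUB (Set.range f) c) :
    IsLUB (Set.range fun k => (f k)⁻¹) c⁻¹ := by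
  have := isLUB_inv h
  rwa [← Set.range_comp] at this

variable [BooleanInverseSemigroup S]

/-- The `(i, j)` entry of a product is the orthogonal join `⨁ₖ aᵢₖ bₖⱼ`. -/
theorem exists_mul_entry (A B : RookMatrix ι S) (i j : ι) :
    ∃ c, IsLUB (Set.range fun k => A.entry i k * B.entry k j) c := by
  obtain ⟨c, h, -⟩ := exists_finite_join _ (terms_finite A B i j)
    (fun k l => terms_compatible A B i j k l)
  exact ⟨c, h⟩

theorem row_aux (A B : RookMatrix ι S) {c : ι → ι → S}
    (hc : ∀ i j, IsLUB (Set.range fun k => A.entry i k * B.entry k j) (c i j))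
    (i j j' : ι) (h : j ≠ j') : (c i j)⁻¹ * c i j' = 0 := by
  have h1 : ∀ k, (c i j)⁻¹ * (A.entry i k * B.entry k j') = 0 := by
    intro k
    have h2 := exists_finite_join (fun l => (A.entry i l * B.entry l j)⁻¹)
      ((terms_finite A B i j).subset fun l hl h0 => hl (by
        have h0 : A.entry i l * B.entry l j = 0 := h0
        rw [h0, inv_zero_eq]))
      (fun k l => (terms_compatible A B i j k l).inv)
    obtain ⟨c', hc', -, hr⟩ := h2
    rw [(isLUB_inv_range (hc i j)).unique hc']
    refine (hr _).unique (isLUB_range_zero fun l => ?_)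
    rw [inv_mul_rev]
    by_cases hlk : l = k
    · subst hlk
      have he := idem_inv_mul (A.entry i l)
      calc (B.entry l j)⁻¹ * (A.entry i l)⁻¹ * (A.entry i l * B.entry l j')
          = (B.entry l j)⁻¹ * ((A.entry i l)⁻¹ * A.entry i l) * B.entry l j' := by
            simp only [mul_assoc]
        _ = 0 := by
            have := inv_mul_le (B.entry l j)⁻¹ (B.entry l j') he
            rw [B.row l j j' h] at this
            exact le_zero_eq this
    · calc (B.entry l j)⁻¹ * (A.entry i l)⁻¹ * (A.entry i k * B.entry k j')
          = (B.entry l j)⁻¹ * ((A.entry i l)⁻¹ * A.entry i k) * B.entry k j' := by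
            simp only [mul_assoc]
        _ = 0 := by rw [A.row i l k hlk, mul_zero, zero_mul]
  exact (mul_isLUB (terms_finite A B i j') (terms_compatible A B i j') (hc i j') _).unique
    (isLUB_range_zero h1)

/-- Multiplication of rook matrices: `(AB)ᵢⱼ = ⨁ₖ aᵢₖ bₖⱼ`. -/
noncomputable instance : Mul (RookMatrix ι S) where
  mul A B :=
    { entry := fun i j => (exists_mul_entry A B i j).choose
      row := row_aux A B fun i j => (exists_mul_entry A B i j).choose_spec
      col := fun i i' j h => by
        have key := row_aux B⁻¹ A⁻¹ (c := fun i j => (exists_mul_entry A B j i).choose⁻¹)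
          (fun i j => by
            have := isLUB_inv_range (exists_mul_entry A B j i).choose_spec
            simpa only [inv_mul_rev, inv_entry] using this) j i i' h
        rwa [inv_inv_self] at key
      finite := by
        refine ((A.finite.image Prod.fst).prod (B.finite.image Prod.snd)).subset ?_
        rintro ⟨i, j⟩ h
        have : ∃ k, A.entry i k * B.entry k j ≠ 0 := by
          by_contra! h0
          exact h ((exists_mul_entry A B i j).choose_spec.unique (isLUB_range_zero h0))
        obtain ⟨k, hk⟩ := this
        refine ⟨⟨(i, k), fun h0 => hk ?_, rfl⟩, ⟨(k, j), fun h0 => hk ?_, rfl⟩⟩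
        · have h0 : A.entry i k = 0 := h0
          rw [h0, zero_mul]
        · have h0 : B.entry k j = 0 := h0
          rw [h0, mul_zero] }

theorem mul_entry (A B : RookMatrix ι S) (i j : ι) :
    IsLUB (Set.range fun k => A.entry i k * B.entry k j) ((A * B).entry i j) :=
  (exists_mul_entry A B i j).choose_spec

theorem mul_entry_eq {A B : RookMatrix ι S} {i j : ι} {c : S}
    (h : IsLUB (Set.range fun k => A.entry i k * B.entry k j) c) : (A * B).entry i j = c :=
  (mul_entry A B i j).unique h

theorem isLUB_range_prod {κ l : Type*} {f : κ → l → S} {g : κ → S} {c : S}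
    (h : ∀ k, IsLUB (Set.range (f k)) (g k)) (hc : IsLUB (Set.range g) c) :
    IsLUB (Set.range fun p : κ × l => f p.1 p.2) c := by
  constructor
  · rintro _ ⟨⟨k, l⟩, rfl⟩
    exact ((h k).1 ⟨l, rfl⟩).trans (hc.1 ⟨k, rfl⟩)
  · intro d hd
    refine hc.2 ?_
    rintro _ ⟨k, rfl⟩
    refine (h k).2 ?_
    rintro _ ⟨l, rfl⟩
    exact hd ⟨(k, l), rfl⟩

theorem mul_mul_entry (A B C : RookMatrix ι S) (i j : ι) :
    IsLUB (Set.range fun p : ι × ι => A.entry i p.2 * B.entry p.2 p.1 * C.entry p.1 j)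
      ((A * B * C).entry i j) :=
  isLUB_range_prod (f := fun k l => A.entry i l * B.entry l k * C.entry k j)
    (fun k => isLUB_mul (terms_finite A B i k) (terms_compatible A B i k) (mul_entry A B i k) _)
    (mul_entry (A * B) C i j)

theorem mul_assoc_aux (A B C : RookMatrix ι S) : A * B * C = A * (B * C) := by
  ext i j
  refine (mul_mul_entry A B C i j).unique ?_
  have := isLUB_range_prod (f := fun k l => A.entry i k * (B.entry k l * C.entry l j))
    (fun k => mul_isLUB (terms_finite B C k j) (terms_compatible B C k j) (mul_entry B C k j) _)
    (mul_entry A (B * C) i j)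
  have e : (Set.range fun p : ι × ι => A.entry i p.1 * (B.entry p.1 p.2 * C.entry p.2 j)) =
      Set.range fun p : ι × ι => A.entry i p.2 * B.entry p.2 p.1 * C.entry p.1 j := by
    ext y
    constructor
    · rintro ⟨⟨k, l⟩, rfl⟩; exact ⟨(l, k), by simp only [mul_assoc]⟩
    · rintro ⟨⟨k, l⟩, rfl⟩; exact ⟨(l, k), by simp only [mul_assoc]⟩
  rwa [e] at this

theorem inv_mul_aux (A B : RookMatrix ι S) : (A * B)⁻¹ = B⁻¹ * A⁻¹ := by
  ext i j
  refine (mul_entry_eq ?_).symm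
  have := isLUB_inv_range (mul_entry A B j i)
  simpa only [inv_mul_rev, inv_entry] using this

noncomputable instance : SemigroupWithZero (RookMatrix ι S) where
  mul_assoc := mul_assoc_aux
  zero_mul A := by
    ext i j
    exact mul_entry_eq (isLUB_range_zero fun k => by simp)
  mul_zero A := by
    ext i j
    exact mul_entry_eq (isLUB_range_zero fun k => by simp)

theorem mul_inv_mul_aux (A : RookMatrix ι S) : A * A⁻¹ * A = A := by
  ext i j
  refine (mul_mul_entry A A⁻¹ A i j).unique ?_
  have := isLUB_range_single (f := fun p : ι × ι =>
    A.entry i p.2 * A⁻¹.entry p.2 p.1 * A.entry p.1 j) (i, j) ?_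
  · simpa only [inv_entry, mul_inv_mul_self] using this
  · rintro ⟨k, l⟩ h
    simp only [inv_entry]
    by_cases hk : k = i
    · subst hk
      have hl : l ≠ j := fun hl => h (by rw [hl])
      rw [mul_assoc, A.row _ _ _ hl, mul_zero]
    · rw [A.col _ _ _ (Ne.symm hk), zero_mul]

theorem mul_inv_diag (A : RookMatrix ι S) :
    (∀ i j, i ≠ j → (A * A⁻¹).entry i j = 0) ∧
      ∀ i, IsIdempotentElem ((A * A⁻¹).entry i i) := by
  have h0 : ∀ i j, i ≠ j → (A * A⁻¹).entry i j = 0 := fun i j h =>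
    mul_entry_eq (isLUB_range_zero fun k => A.col _ _ _ h)
  refine ⟨h0, fun i => ?_⟩
  have h1 : (A * A⁻¹) * (A * A⁻¹) = A * A⁻¹ := by
    rw [← mul_assoc_aux, mul_inv_mul_aux]
  have h2 : ((A * A⁻¹) * (A * A⁻¹)).entry i i = (A * A⁻¹).entry i i * (A * A⁻¹).entry i i :=
    mul_entry_eq (isLUB_range_single (f := fun k => (A * A⁻¹).entry i k * (A * A⁻¹).entry k i) i
      fun k hk => by rw [h0 _ _ hk, mul_zero])
  rw [IsIdempotentElem, ← h2, h1]

theorem diag_mul_entry {P : RookMatrix ι S} (hP : ∀ i j, i ≠ j → P.entry i j = 0)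
    (Q : RookMatrix ι S) (i j : ι) : (P * Q).entry i j = P.entry i i * Q.entry i j :=
  mul_entry_eq (isLUB_range_single (f := fun k => P.entry i k * Q.entry k j) i
    fun k hk => by rw [hP _ _ (Ne.symm hk), zero_mul])

theorem mul_diag_entry {P : RookMatrix ι S} (hP : ∀ i j, i ≠ j → P.entry i j = 0)
    (Q : RookMatrix ι S) (i j : ι) : (Q * P).entry i j = Q.entry i j * P.entry j j :=
  mul_entry_eq (isLUB_range_single (f := fun k => Q.entry i k * P.entry k j) j
    fun k hk => by rw [hP _ _ hk, mul_zero])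

/-- Rook matrices form an inverse semigroup with zero. -/
noncomputable instance : InverseSemigroupWithZero (RookMatrix ι S) :=
  ofInvolution mul_inv_mul_aux
    (fun A => by ext i j; simp [inv_inv_self]) inv_mul_aux
    (fun A B => by
      obtain ⟨hA, hA'⟩ := mul_inv_diag A
      obtain ⟨hB, hB'⟩ := mul_inv_diag B
      ext i j
      rw [diag_mul_entry hA, diag_mul_entry hB]
      by_cases h : i = j
      · subst h; exact idem_comm (hA' i) (hB' i)
      · rw [hA _ _ h, hB _ _ h, mul_zero, mul_zero])

/-- The idempotent rook matrices are the diagonal ones with idempotent entries. -/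
theorem isIdempotentElem_iff {A : RookMatrix ι S} : IsIdempotentElem A ↔
    (∀ i j, i ≠ j → A.entry i j = 0) ∧ ∀ i, IsIdempotentElem (A.entry i i) := by
  constructor
  · intro h
    have := mul_inv_diag A
    rwa [inv_of_idem h, h.eq] at this
  · rintro ⟨h1, h2⟩
    ext i j
    rw [diag_mul_entry h1]
    by_cases h : i = j
    · subst h; exact h2 i
    · rw [h1 _ _ h, mul_zero]

theorem inv_mul_entry_ne (A : RookMatrix ι S) {i j : ι} (h : i ≠ j) :
    (A⁻¹ * A).entry i j = 0 :=
  (isIdempotentElem_iff.1 (idem_inv_mul A)).1 i j h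

/-- The natural order of rook matrices is entrywise. -/
theorem le_iff {A B : RookMatrix ι S} : A ≤ B ↔ ∀ i j, A.entry i j ≤ B.entry i j := by
  constructor
  · intro h i j
    obtain ⟨e, he, rfl⟩ := le_iff_right.1 h
    obtain ⟨h1, h2⟩ := isIdempotentElem_iff.1 he
    rw [mul_diag_entry h1]
    exact le_iff_right.2 ⟨_, h2 j, rfl⟩
  · intro h
    rw [le_def]
    ext i j
    refine (IsLUB.unique (mul_mul_entry B A⁻¹ A i j) ?_).symm
    have := isLUB_range_single (f := fun p : ι × ι =>
      B.entry i p.2 * A⁻¹.entry p.2 p.1 * A.entry p.1 j) (i, j) ?_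
    · have h' := le_def.1 (h i j)
      simp only [inv_entry] at this
      rwa [← h'] at this
    · rintro ⟨k, l⟩ hkl
      simp only [inv_entry]
      by_cases hl : l = j
      · subst hl
        have hk : i ≠ k := fun hk => hkl (by rw [hk])
        have := mul_le_left (B.entry i l) (inv_le (h k l))
        rw [B.col _ _ _ hk] at this
        rw [le_zero_eq this, zero_mul]
      · rw [mul_assoc, A.row _ _ _ hl, mul_zero]

theorem isLUB_of_entries {A B C : RookMatrix ι S}
    (h : ∀ i j, IsLUB {A.entry i j, B.entry i j} (C.entry i j)) : IsLUB {A, B} C := by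
  constructor
  · rintro D (rfl | rfl)
    · exact le_iff.2 fun i j => (h i j).1 (by simp)
    · exact le_iff.2 fun i j => (h i j).1 (by simp)
  · intro D hD
    refine le_iff.2 fun i j => (h i j).2 ?_
    rintro x (rfl | rfl)
    · exact le_iff.1 (hD (by simp)) i j
    · exact le_iff.1 (hD (by simp)) i j

theorem inv_mul_entries {A B : RookMatrix ι S} (h : IsIdempotentElem (A⁻¹ * B))
    (k i j : ι) : IsIdempotentElem ((A.entry k i)⁻¹ * B.entry k j) ∧
      (i ≠ j → (A.entry k i)⁻¹ * B.entry k j = 0) := by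
  obtain ⟨h1, h2⟩ := isIdempotentElem_iff.1 h
  have hle : (A.entry k i)⁻¹ * B.entry k j ≤ (A⁻¹ * B).entry i j :=
    (mul_entry A⁻¹ B i j).1 ⟨k, rfl⟩
  by_cases hij : i = j
  · subst hij
    exact ⟨idem_of_le (h2 i) hle, fun hne => (hne rfl).elim⟩
  · rw [h1 i j hij] at hle
    rw [le_zero_eq hle]
    exact ⟨by simp [IsIdempotentElem], fun _ => rfl⟩

theorem compatible_entries {A B : RookMatrix ι S} (h : Compatible A B) (i j : ι) :
    Compatible (A.entry i j) (B.entry i j) := by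
  refine ⟨(inv_mul_entries h.1 i j j).1, ?_⟩
  have := (inv_mul_entries (A := A⁻¹) (B := B⁻¹) (by rw [inv_inv_self]; exact h.2) j i i).1
  simpa only [inv_entry, inv_inv_self] using this

theorem join_row_aux {A B : RookMatrix ι S} (h : Compatible A B) {c : ι → ι → S}
    (hc : ∀ i j, IsLUB {A.entry i j, B.entry i j} (c i j)) (i j j' : ι) (hj : j ≠ j') :
    (c i j)⁻¹ * c i j' = 0 := by
  have hz : ∀ x y : S, x = 0 → y = 0 → ∀ z, IsLUB {x, y} z → z = 0 := by
    rintro x y rfl rfl z hz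
    exact (isLUB_insert_zero.1 hz).unique isLUB_singleton
  refine hz _ _ ?_ ?_ _ (mul_join (c i j)⁻¹ _ _ _ (compatible_entries h i j') (hc i j'))
  all_goals
    have h1 := isLUB_inv (hc i j)
    rw [Set.image_pair] at h1
    refine hz _ _ ?_ ?_ _ (join_mul _ _ _ _ (compatible_entries h i j).inv h1)
  · exact A.row _ _ _ hj
  · exact (inv_mul_entries h.symm.1 i j j').2 hj
  · exact (inv_mul_entries h.1 i j j').2 hj
  · exact B.row _ _ _ hj

theorem exists_entry_join {A B : RookMatrix ι S} (h : Compatible A B) :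
    ∃ C : RookMatrix ι S, ∀ i j, IsLUB {A.entry i j, B.entry i j} (C.entry i j) := by
  choose c hc using fun i j => exists_join _ _ (compatible_entries h i j)
  refine ⟨⟨c, join_row_aux h hc, fun i i' j hi => ?_, ?_⟩, hc⟩
  · have := join_row_aux h.inv (c := fun i j => (c j i)⁻¹) (fun i j => by
      have := isLUB_inv (hc j i)
      rwa [Set.image_pair] at this) j i i' hi
    rwa [inv_inv_self] at this
  · refine (A.finite.union B.finite).subset ?_
    rintro ⟨i, j⟩ h0
    by_contra h1
    simp only [Set.mem_union, not_or] at h1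
    have ha : A.entry i j = 0 := not_not.1 h1.1
    have hb : B.entry i j = 0 := not_not.1 h1.2
    have := hc i j
    rw [ha, hb] at this
    exact h0 ((isLUB_insert_zero.1 this).unique isLUB_singleton)

theorem entries_of_isLUB {A B C : RookMatrix ι S} (h : Compatible A B)
    (hC : IsLUB {A, B} C) (i j : ι) : IsLUB {A.entry i j, B.entry i j} (C.entry i j) := by
  obtain ⟨D, hD⟩ := exists_entry_join h
  rw [hC.unique (isLUB_of_entries hD)]
  exact hD i j

theorem mul_join_aux (D A B C : RookMatrix ι S) (h : Compatible A B)
    (hC : IsLUB {A, B} C) : IsLUB {D * A, D * B} (D * C) := by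
  refine isLUB_of_entries fun i j => ?_
  have h1 : ∀ k, IsLUB {D.entry i k * A.entry k j, D.entry i k * B.entry k j}
      (D.entry i k * C.entry k j) := fun k =>
    mul_join _ _ _ _ (compatible_entries h k j) (entries_of_isLUB h hC k j)
  constructor
  · rintro x (rfl | rfl)
    · refine (mul_entry D A i j).2 ?_
      rintro _ ⟨k, rfl⟩
      exact ((h1 k).1 (by simp)).trans ((mul_entry D C i j).1 ⟨k, rfl⟩)
    · refine (mul_entry D B i j).2 ?_
      rintro _ ⟨k, rfl⟩
      exact ((h1 k).1 (by simp)).trans ((mul_entry D C i j).1 ⟨k, rfl⟩)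
  · intro y hy
    refine (mul_entry D C i j).2 ?_
    rintro _ ⟨k, rfl⟩
    refine (h1 k).2 ?_
    rintro x (rfl | rfl)
    · exact ((mul_entry D A i j).1 ⟨k, rfl⟩).trans (hy (by simp))
    · exact ((mul_entry D B i j).1 ⟨k, rfl⟩).trans (hy (by simp))

/-- The diagonal rook matrix with entries `d i`. -/
theorem exists_diag (d : ι → S) (hd : {i | d i ≠ 0}.Finite) :
    ∃ D : RookMatrix ι S, (∀ i, D.entry i i = d i) ∧ ∀ i j, i ≠ j → D.entry i j = 0 := by
  classical
  refine ⟨⟨fun i j => if i = j then d i else 0, fun i j j' h => ?_, fun i i' j h => ?_, ?_⟩,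
    fun i => by simp, fun i j h => by simp [h]⟩
  · by_cases h1 : i = j
    · have : i ≠ j' := fun h2 => h (h1 ▸ h2)
      simp [this]
    · simp [h1, inv_zero_eq]
  · by_cases h1 : i = j
    · have : i' ≠ j := fun h2 => h (h1.trans h2.symm)
      simp [this, inv_zero_eq]
    · simp [h1]
  · refine (hd.image fun i => (i, i)).subset ?_
    rintro ⟨i, j⟩ h
    by_cases hij : i = j
    · subst hij
      exact ⟨i, by simpa using h, rfl⟩
    · simp [hij] at h

/-- Rook matrices over a Boolean inverse semigroup form a Boolean inverse semigroup. -/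
instance : BooleanInverseSemigroup (RookMatrix ι S) where
  exists_join A B h := by
    obtain ⟨C, hC⟩ := exists_entry_join h
    exact ⟨C, isLUB_of_entries hC⟩
  mul_join := mul_join_aux
  join_mul D A B C h hC := by
    have h1 := isLUB_inv hC
    rw [Set.image_pair] at h1
    have h2 := isLUB_inv (mul_join_aux D⁻¹ _ _ _ h.inv h1)
    rw [Set.image_pair] at h2
    simpa only [inv_mul_rev, inv_inv_self] using h2
  exists_relative_complement E F hE hF hEF := by
    obtain ⟨hE1, hE2⟩ := isIdempotentElem_iff.1 hE
    obtain ⟨hF1, hF2⟩ := isIdempotentElem_iff.1 hF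
    choose g hg1 hg2 hg3 using fun i =>
      exists_relative_complement _ _ (hE2 i) (hF2 i) (le_iff.1 hEF i i)
    obtain ⟨G, hG1, hG2⟩ := exists_diag g (by
      refine (F.finite_diag).subset fun i hi h0 => hi ?_
      have h0 : F.entry i i = 0 := h0
      have := (hg3 i).1 (show g i ∈ _ by simp)
      rw [h0] at this
      exact le_zero_eq this)
    refine ⟨G, isIdempotentElem_iff.2 ⟨hG2, fun i => by rw [hG1]; exact hg1 i⟩, ?_, ?_⟩
    · ext i j
      rw [diag_mul_entry hE1]
      by_cases hij : i = j
      · subst hij; rw [hG1, hg2]; rfl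
      · rw [hG2 _ _ hij, mul_zero]; rfl
    · refine isLUB_of_entries fun i j => ?_
      by_cases hij : i = j
      · subst hij; rw [hG1]; exact hg3 i
      · rw [hE1 _ _ hij, hF1 _ _ hij, hG2 _ _ hij, isLUB_insert_zero]
        exact isLUB_singleton

end RookMatrix

/-- The Boolean inverse semigroup `M_ω(S)` of `ω × ω` rook matrices over `S`. -/
abbrev OmegaRook (S : Type*) [InverseSemigroupWithZero S] : Type _ := RookMatrix ℕ S

/-- `M_ω(S)` is orthogonally separating: shift the diagonal of `f` past the support of `e`. -/
instance {S : Type*} [InverseSemigroupWithZero S] [BooleanInverseSemigroup S] :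
    OrthogonallySeparating (OmegaRook S) where
  exists_orthogonal := by
    rintro ⟨E, hE⟩ ⟨F, hF⟩
    obtain ⟨hE1, hE2⟩ := RookMatrix.isIdempotentElem_iff.1 hE
    obtain ⟨hF1, hF2⟩ := RookMatrix.isIdempotentElem_iff.1 hF
    obtain ⟨n, hn⟩ := E.finite_diag.bddAbove
    have hn' : ∀ i, n < i → E.entry i i = 0 := fun i hi => by
      by_contra h
      exact absurd (hn h) (not_le.2 hi)
    let A : RookMatrix ℕ S :=
      { entry := fun i j => if i = j + (n + 1) then F.entry j j else 0
        row := fun i j j' h => by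
          by_cases h1 : i = j + (n + 1)
          · have : i ≠ j' + (n + 1) := by omega
            simp [this]
          · simp [h1, inv_zero_eq]
        col := fun i i' j h => by
          by_cases h1 : i = j + (n + 1)
          · have : i' ≠ j + (n + 1) := by omega
            simp [this, inv_zero_eq]
          · simp [h1]
        finite := by
          refine (F.finite_diag.image fun j => (j + (n + 1), j)).subset ?_
          rintro ⟨i, j⟩ h
          by_cases hij : i = j + (n + 1)
          · subst hij
            exact ⟨j, by simpa using h, rfl⟩
          · simp [hij] at h }
    have hA : ∀ i j, A.entry i j = if i = j + (n + 1) then F.entry j j else 0 := fun _ _ => rfl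
    have hAF : A⁻¹ * A = F := by
      ext i j
      by_cases hij : i = j
      · subst hij
        refine RookMatrix.mul_entry_eq ?_
        have := isLUB_range_single (f := fun k => A⁻¹.entry i k * A.entry k i) (i + (n + 1))
          fun k hk => by rw [hA, if_neg hk, mul_zero]
        have hF' : A⁻¹.entry i (i + (n + 1)) * A.entry (i + (n + 1)) i = F.entry i i := by
          rw [RookMatrix.inv_entry, hA, if_pos rfl, inv_of_idem (hF2 i), (hF2 i).eq]
        rwa [hF'] at this
      · rw [RookMatrix.inv_mul_entry_ne A hij, hF1 _ _ hij]
    refine ⟨⟨E, hE⟩, ⟨A * A⁻¹, idem_mul_inv A⟩, dRel_refl _, DRel.symm ?_, ?_⟩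
    · exact (dRel_idem hF (idem_mul_inv A)).2 ⟨A, hAF, rfl⟩
    · rw [orthogonal_idem hE (idem_mul_inv A), ← mul_assoc]
      have : E * A = 0 := by
        ext i j
        rw [RookMatrix.diag_mul_entry hE1, hA]
        by_cases hij : i = j + (n + 1)
        · rw [hn' i (by omega), zero_mul]; rfl
        · rw [if_neg hij, mul_zero]; rfl
      rw [this, zero_mul]

/-- The type monoid `T(S) = E(M_ω(S))/𝒟`, with addition `[e] + [f] = [e' ∨ f']` for `e' 𝒟 e`,
`f' 𝒟 f` and `e' ⟂ f'`. -/
abbrev TypeMonoid (S : Type*) [InverseSemigroupWithZero S] [BooleanInverseSemigroup S] : Type _ :=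
  IdempotentClasses (OmegaRook S)

end RookMatrices

end BooleanInverse

/-! Both directions compare the order on idempotents with addition of classes: if `f ≤ e` has
relative complement `g`, then `[e] = [f] + [g]`, and conversely any summand of `[e]` is the class of
some `f ≤ e`. The classes of idempotents of `S` itself, placed in the corner of a rook matrix,
generate the type monoid (`mem_of_forall_ofIdem_mem`).

Suppose `S` is `0`-simplifying and semisimple. Finiteness gives a minimal idempotent `p`. The
elements whose domain contains only minimal idempotents `𝒟`-related to `p` form a non-zero additive
ideal, hence all of `S`, so there is just one `𝒟`-class of minimal idempotents
(`dRel_of_isMinimalIdempotent`). Splitting off minimal idempotents one at a time writes every class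
as a multiple of `[p]`. The multiples are distinct: the number of elements below an idempotent is a
`𝒟`-invariant that turns orthogonal joins into products (`natCard_Iic_join`), and it takes the value
`2 ^ n` on `n • [p]`.

Suppose conversely that `φ` is an isomorphism onto `ℕ`, and call `φ [e]` the rank of `e`. Rank is
additive over orthogonal joins and positive on non-zero idempotents, so induction on rank shows that
only finitely many elements lie below an idempotent, and then below any element. Every non-zero
idempotent dominates one of rank `1`, and injectivity of `φ` makes all rank-`1` idempotents
`𝒟`-related. A non-zero additive ideal contains one of them, hence all, hence every idempotent by
induction on rank, hence everything. -/

open InverseSemigroupWithZero BooleanInverseSemigroup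

/-! ### Conjugation and minimal idempotents -/

namespace InverseSemigroupWithZero

variable {T : Type*} [InverseSemigroupWithZero T]

theorem mul_eq_of_le_idem {a e : T} (he : IsIdempotentElem e) (h : a ≤ e) : a * e = a := by
  obtain ⟨f, hf, rfl⟩ := le_iff_left.1 h
  rw [mul_assoc, he.eq]

theorem idem_mul_eq_of_le {a e : T} (he : IsIdempotentElem e) (h : a ≤ e) : e * a = a := by
  obtain ⟨f, hf, rfl⟩ := le_iff_right.1 h
  rw [← mul_assoc, he.eq]

theorem mul_idem_le (a : T) {e : T} (he : IsIdempotentElem e) : a * e ≤ a :=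
  le_iff_right.2 ⟨e, he, rfl⟩

theorem idem_mul_le (a : T) {e : T} (he : IsIdempotentElem e) : e * a ≤ a :=
  le_iff_left.2 ⟨e, he, rfl⟩

theorem idem_conj_inv (a : T) {e : T} (he : IsIdempotentElem e) :
    IsIdempotentElem (a * e * a⁻¹) := by
  have := idem_conj a⁻¹ he
  rwa [inv_inv_self] at this

theorem conj_le_conj (x : T) {a b : T} (h : a ≤ b) : x * a * x⁻¹ ≤ x * b * x⁻¹ :=
  mul_le_right _ (mul_le_left _ h)

theorem inv_conj_conj {x a : T} (h : a ≤ x⁻¹ * x) : x⁻¹ * (x * a * x⁻¹) * x = a := by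
  calc x⁻¹ * (x * a * x⁻¹) * x = (x⁻¹ * x) * a * (x⁻¹ * x) := by simp only [mul_assoc]
    _ = a := by
      rw [idem_mul_eq_of_le (idem_inv_mul x) h, mul_eq_of_le_idem (idem_inv_mul x) h]

theorem conj_inv_conj {x a : T} (h : a ≤ x * x⁻¹) : x * (x⁻¹ * a * x) * x⁻¹ = a := by
  have := inv_conj_conj (x := x⁻¹) (a := a) (by rwa [inv_inv_self])
  rwa [inv_inv_self] at this

theorem conj_inv_mul (x : T) : x * (x⁻¹ * x) * x⁻¹ = x * x⁻¹ := by rw [mim]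

theorem inv_conj_mul_inv (x : T) : x⁻¹ * (x * x⁻¹) * x = x⁻¹ * x := by rw [imi]

/-- Conjugation by `x` is a bijection from the elements below `x⁻¹x` to those below `xx⁻¹`. -/
def iicConjEquiv (x : T) : Set.Iic (x⁻¹ * x) ≃ Set.Iic (x * x⁻¹) where
  toFun a := ⟨x * a.1 * x⁻¹, (conj_le_conj x a.2).trans_eq (conj_inv_mul x)⟩
  invFun a := ⟨x⁻¹ * a.1 * x,
    (mul_le_right _ (mul_le_left _ a.2)).trans_eq (inv_conj_mul_inv x)⟩
  left_inv a := Subtype.ext (inv_conj_conj a.2)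
  right_inv a := Subtype.ext (conj_inv_conj a.2)

theorem natCard_Iic_eq_of_dRel {e f : T} (he : IsIdempotentElem e) (hf : IsIdempotentElem f)
    (h : DRel e f) : Nat.card (Set.Iic e) = Nat.card (Set.Iic f) := by
  obtain ⟨x, rfl, rfl⟩ := (dRel_idem he hf).1 h
  exact Nat.card_congr (iicConjEquiv x)

theorem eq_zero_of_inv_mul {x : T} (h : x⁻¹ * x = 0) : x = 0 := by
  rw [← mim x, h, mul_zero]

theorem eq_zero_of_dRel_zero {e : T} (he : IsIdempotentElem e) (h : DRel e 0) : e = 0 := by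
  obtain ⟨x, hx, hx'⟩ := (dRel_idem he (by simp [IsIdempotentElem])).1 h
  have : x = 0 := by rw [← mul_inv_mul_self x, hx', zero_mul]
  rw [← hx, this, mul_zero]

/-- The restriction `x * q` of `x` has domain `q` and range `x * q * x⁻¹`. -/
theorem dRel_conj {x q : T} (hq : IsIdempotentElem q) (h : q ≤ x⁻¹ * x) :
    DRel q (x * q * x⁻¹) := by
  refine (dRel_idem hq (idem_conj_inv x hq)).2 ⟨x * q, ?_, ?_⟩
  · rw [inv_mul_rev, inv_of_idem hq]
    calc q * x⁻¹ * (x * q) = q * ((x⁻¹ * x) * q) := by simp only [mul_assoc]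
      _ = q := by rw [idem_mul_eq_of_le (idem_inv_mul x) h, hq.eq]
  · rw [inv_mul_rev, inv_of_idem hq]
    calc x * q * (q * x⁻¹) = x * (q * q) * x⁻¹ := by simp only [mul_assoc]
      _ = x * q * x⁻¹ := by rw [hq.eq]

/-- A nonzero idempotent with nothing strictly between it and `0`. -/
structure IsMinimalIdempotent (q : T) : Prop where
  idem : IsIdempotentElem q
  ne_zero : q ≠ 0
  eq_or_eq : ∀ x ≤ q, x = 0 ∨ x = q

/-- Anything below the conjugate is pulled back by `x` to an element below `q`, where minimality
applies, and conjugating forward recovers it. -/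
theorem IsMinimalIdempotent.conj {x q : T} (hq : IsMinimalIdempotent q) (h : q ≤ x⁻¹ * x) :
    IsMinimalIdempotent (x * q * x⁻¹) := by
  refine ⟨idem_conj_inv x hq.idem, fun h0 => hq.ne_zero ?_, fun y hy => ?_⟩
  · rw [← inv_conj_conj h, h0, mul_zero, zero_mul]
  · have h1 : x⁻¹ * y * x ≤ q :=
      (mul_le_right _ (mul_le_left _ hy)).trans_eq (inv_conj_conj h)
    have h2 : y ≤ x * x⁻¹ := hy.trans ((conj_le_conj x h).trans_eq (conj_inv_mul x))
    rw [← conj_inv_conj h2]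
    rcases hq.eq_or_eq _ h1 with h3 | h3
    · left; rw [h3, mul_zero, zero_mul]
    · right; rw [h3]

theorem IsMinimalIdempotent.natCard_Iic {q : T} (hq : IsMinimalIdempotent q) :
    Nat.card (Set.Iic q) = 2 := by
  have : Set.Iic q = {0, q} := by
    ext x
    constructor
    · exact fun h => hq.eq_or_eq x h
    · rintro (rfl | rfl)
      · exact zero_le_elem q
      · exact le_refl x
  rw [this, Nat.card_coe_set_eq, Set.ncard_pair hq.ne_zero.symm]

theorem exists_isMinimalIdempotent_le (hS : IsSemisimpleInverse T) {e : T}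
    (he : IsIdempotentElem e) (h0 : e ≠ 0) : ∃ q ≤ e, IsMinimalIdempotent q := by
  obtain ⟨q, hqe, hq⟩ := Set.Finite.exists_le_minimal
    ((hS e).subset (t := {x | x ≤ e ∧ x ≠ 0}) fun x hx => hx.1) ⟨le_refl e, h0⟩
  refine ⟨q, hqe, idem_of_le he hqe, hq.1.2, fun x hx => ?_⟩
  by_cases hx0 : x = 0
  · exact Or.inl hx0
  · exact Or.inr (le_antisymm hx (hq.2 ⟨hx.trans hqe, hx0⟩ hx))

/-- Each `b ≤ a` is recovered as `a * (a⁻¹ * b)` from `a⁻¹ * b`, which lies below the domain `a⁻¹ *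
a`. This reduces semisimplicity to idempotents. -/
theorem finite_Iic_of_finite_Iic_inv_mul {a : T} (h : (Set.Iic (a⁻¹ * a)).Finite) :
    (Set.Iic a).Finite := by
  refine (h.image fun e => a * e).subset fun b hb => ⟨a⁻¹ * b, mul_le_left _ hb, ?_⟩
  obtain ⟨e, he, rfl⟩ := le_iff_right.1 hb
  change a * (a⁻¹ * (a * e)) = a * e
  rw [← mul_assoc, ← mul_assoc, mul_inv_mul_self]

end InverseSemigroupWithZero

/-! ### Order ideals of orthogonal joins; the additive ideal of a minimal idempotent -/

namespace BooleanInverseSemigroup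

variable {T : Type*} [InverseSemigroupWithZero T] [BooleanInverseSemigroup T]

theorem eq_zero_of_isLUB_zero {c : T} (h : IsLUB {0, 0} c) : c = 0 :=
  (isLUB_insert_zero.1 h).unique isLUB_singleton

/-- Distributivity applied to `x = x * g`: an element below a join is determined by its two
restrictions. -/
theorem isLUB_mul_pair {e f g x : T} (he : IsIdempotentElem e) (hf : IsIdempotentElem f)
    (hg : IsLUB {e, f} g) (hx : x ≤ g) : IsLUB {x * e, x * f} x := by
  have := mul_join x e f g (Compatible.of_idem he hf) hg
  rwa [mul_eq_of_le_idem (idem_join he hf hg) hx] at this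

theorem join_mul_eq {e f y z w : T} (he : IsIdempotentElem e) (hf : IsIdempotentElem f)
    (hef : e * f = 0) (hy : y ≤ e) (hz : z ≤ f) (hw : IsLUB {y, z} w) : w * e = y := by
  have hz0 : z * e = 0 := by
    rw [← mul_eq_of_le_idem hf hz, mul_assoc, idem_comm hf he, hef, mul_zero]
  have h := join_mul e y z w (Compatible.of_idem (idem_of_le he hy) (idem_of_le hf hz)) hw
  rw [mul_eq_of_le_idem he hy, hz0, Set.pair_comm] at h
  exact (isLUB_insert_zero.1 h).unique isLUB_singleton

/-- The map `x ↦ (x * e, x * f)` is a bijection whose inverse is the join. No finiteness is needed,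
since `Nat.card` is multiplicative on products even with its value `0` on infinite types. -/
theorem natCard_Iic_join {e f g : T} (he : IsIdempotentElem e) (hf : IsIdempotentElem f)
    (hef : e * f = 0) (hg : IsLUB {e, f} g) :
    Nat.card (Set.Iic g) = Nat.card (Set.Iic e) * Nat.card (Set.Iic f) := by
  rw [← Nat.card_prod]
  have hgi := idem_join he hf hg
  refine Nat.card_congr (Equiv.ofBijective (fun x => (⟨x.1 * e, ?_⟩, ⟨x.1 * f, ?_⟩)) ⟨?_, ?_⟩)
  · exact idem_mul_le e (idem_of_le hgi x.2)
  · exact idem_mul_le f (idem_of_le hgi x.2)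
  · intro x y hxy
    have hxe : x.1 * e = y.1 * e := congrArg (fun p => p.1.1) hxy
    have hxf : x.1 * f = y.1 * f := congrArg (fun p => p.2.1) hxy
    have hx := isLUB_mul_pair he hf hg x.2
    rw [hxe, hxf] at hx
    exact Subtype.ext (hx.unique (isLUB_mul_pair he hf hg y.2))
  · rintro ⟨⟨y, hy⟩, ⟨z, hz⟩⟩
    obtain ⟨w, hw⟩ := exists_join y z (Compatible.of_idem (idem_of_le he hy) (idem_of_le hf hz))
    refine ⟨⟨w, hw.2 ?_⟩, ?_⟩
    · rintro u (rfl | rfl)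
      · exact le_trans hy (hg.1 (by simp))
      · exact le_trans hz (hg.1 (by simp))
    · ext
      · exact join_mul_eq he hf hef hy hz hw
      · exact join_mul_eq hf he (by rw [idem_comm hf he, hef]) hz hy (by rwa [Set.pair_comm])

/-- The elements `a` such that all minimal idempotents below `a⁻¹a` are `𝒟`-related to `p` form an
additive ideal. -/
theorem isAdditiveIdeal_minimal_dRel (p : T) :
    IsAdditiveIdeal {a : T | ∀ q, IsMinimalIdempotent q → q ≤ a⁻¹ * a → DRel q p} where
  zero_mem q hq h := by
    rw [mul_zero] at h
    exact (hq.ne_zero (le_zero_eq h)).elim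
  mul_mem_left s a ha q hq h := by
    refine ha q hq (h.trans ?_)
    calc (s * a)⁻¹ * (s * a) = a⁻¹ * (s⁻¹ * s) * a := by
          rw [inv_mul_rev]; simp only [mul_assoc]
      _ ≤ a⁻¹ * a := inv_mul_le _ _ (idem_inv_mul s)
  mul_mem_right s a ha q hq h := by
    have h1 : (a * s)⁻¹ * (a * s) = s⁻¹ * (a⁻¹ * a) * s := by
      rw [inv_mul_rev]; simp only [mul_assoc]
    rw [h1] at h
    -- Since `q` lies below the domain of `s`, it is `𝒟`-related to its conjugate `s * q * s⁻¹`, a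
    -- minimal idempotent below `a⁻¹ * a`.
    have h2 : q ≤ s⁻¹ * s := h.trans (inv_mul_le _ _ (idem_inv_mul a))
    refine (dRel_conj hq.idem h2).trans (ha _ (hq.conj h2) ?_)
    refine (conj_le_conj s h).trans ?_
    calc s * (s⁻¹ * (a⁻¹ * a) * s) * s⁻¹ = (s * s⁻¹) * ((a⁻¹ * a) * (s * s⁻¹)) := by
          simp only [mul_assoc]
      _ ≤ (a⁻¹ * a) * (s * s⁻¹) := idem_mul_le _ (idem_mul_inv s)
      _ ≤ a⁻¹ * a := mul_idem_le _ (idem_mul_inv s)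
  join_mem a b c ha hb hab hc q hq h := by
    -- Minimality gives a dichotomy: `d` either kills `q` or has `q` in its domain. As `c` does not
    -- kill `q`, distributivity shows that `a` and `b` cannot both kill it.
    have key : ∀ d : T, d * q ≠ 0 → q ≤ d⁻¹ * d := by
      intro d hd
      have hi := idem_inv_mul d
      rcases hq.eq_or_eq (d⁻¹ * d * q) (idem_mul_le q hi) with h1 | h1
      · refine (hd ?_).elim
        rw [← mul_inv_mul_self d, mul_assoc d, mul_assoc d, h1, mul_zero]
      · rw [← h1]
        exact mul_idem_le _ hq.idem
    by_cases ha0 : a * q = 0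
    · by_cases hb0 : b * q = 0
      · have h1 := join_mul q a b c hab hc
        rw [ha0, hb0] at h1
        have h2 := idem_mul_eq_of_le (idem_inv_mul c) h
        rw [mul_assoc, eq_zero_of_isLUB_zero h1, mul_zero] at h2
        exact (hq.ne_zero h2.symm).elim
      · exact hb q hq (key b hb0)
    · exact ha q hq (key a ha0)

/-- The additive ideal attached to `p` contains `p`, because `p` is the only minimal idempotent
below itself. It is therefore not `{0}`, so it is everything and contains `q`. -/
theorem dRel_of_isMinimalIdempotent (hS : IsZeroSimplifying T) {p q : T}
    (hp : IsMinimalIdempotent p) (hq : IsMinimalIdempotent q) : DRel q p := by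
  have hself : ∀ {e : T}, IsIdempotentElem e → e⁻¹ * e = e := fun he => by
    rw [inv_of_idem he, he.eq]
  rcases hS.2 _ (isAdditiveIdeal_minimal_dRel p) with h | h
  · have : p ∈ {a : T | ∀ q, IsMinimalIdempotent q → q ≤ a⁻¹ * a → DRel q p} := by
      intro r hr hrp
      rw [hself hp.idem] at hrp
      rw [(hp.eq_or_eq r hrp).resolve_left hr.ne_zero]
      exact dRel_refl p
    rw [h] at this
    exact (hp.ne_zero this).elim
  · have : q ∈ {a : T | ∀ q, IsMinimalIdempotent q → q ≤ a⁻¹ * a → DRel q p} := by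
      rw [h]; trivial
    exact this q hq (hself hq.idem).ge

end BooleanInverseSemigroup

/-! ### Sums of `𝒟`-classes and the counting invariant -/

namespace IdempotentClasses

variable {T : Type*} [InverseSemigroupWithZero T]

/-- The class of an idempotent. -/
def mk (e : T) (he : IsIdempotentElem e) : IdempotentClasses T :=
  Quotient.mk (idempotentSetoid T) ⟨e, he⟩

theorem mk_eq_mk {e f : T} {he : IsIdempotentElem e} {hf : IsIdempotentElem f} :
    mk e he = mk f hf ↔ DRel e f :=
  ⟨fun h => Quotient.exact h, fun h => Quotient.sound (s := idempotentSetoid T) h⟩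

theorem exists_rep (x : IdempotentClasses T) : ∃ e he, x = mk (T := T) e he := by
  induction x using Quotient.inductionOn with | _ e
  exact ⟨e.1, e.2, rfl⟩

/-- The number of elements below a representative. -/
noncomputable def iicCard (x : IdempotentClasses T) : ℕ :=
  Quotient.lift (s := idempotentSetoid T) (fun e => Nat.card (Set.Iic e.1))
    (fun e f h => natCard_Iic_eq_of_dRel e.2 f.2 h) x

theorem mk_eq_zero {e : T} {he : IsIdempotentElem e} : mk e he = 0 ↔ e = 0 := by
  constructor
  · intro h
    exact eq_zero_of_dRel_zero he (Quotient.exact h)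
  · rintro rfl
    rfl

theorem iicCard_zero : iicCard (0 : IdempotentClasses T) = 1 := by
  change Nat.card (Set.Iic (0 : T)) = 1
  have : Set.Iic (0 : T) = {0} := Set.ext fun x => ⟨le_zero_eq, fun h => le_of_eq h⟩
  rw [this, Nat.card_unique]

variable [BooleanInverseSemigroup T] [OrthogonallySeparating T]

theorem mk_join {e f g : T} (he : IsIdempotentElem e) (hf : IsIdempotentElem f)
    (hg : IsIdempotentElem g) (hef : e * f = 0) (h : IsLUB {e, f} g) :
    mk g hg = mk e he + mk f hf :=
  IsClassSum.unique
    ⟨⟨e, he⟩, ⟨f, hf⟩, ⟨g, hg⟩, (orthogonal_idem he hf).2 hef, h, rfl, rfl, rfl⟩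
    (isClassSum_add _ _)

/-- The sum is represented by an orthogonal join `k` with `k 𝒟 g`; conjugating by an element that
realises this relation carries the first summand of `k` to an idempotent below `g`. -/
theorem exists_le_of_mk_eq_add {g : T} {hg : IsIdempotentElem g} {x y : IdempotentClasses T}
    (h : mk g hg = x + y) : ∃ e he, e ≤ g ∧ mk e he = x := by
  obtain ⟨e, f, k, -, hk, rfl, rfl, hz⟩ := isClassSum_add x y
  rw [hz] at h
  obtain ⟨u, hu, rfl⟩ := (dRel_idem k.2 hg).1 (DRel.symm (Quotient.exact h))
  have hek : e.1 ≤ u⁻¹ * u := (hk.1 (by simp)).trans_eq hu.symm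
  exact ⟨u * e.1 * u⁻¹, idem_conj_inv u e.2, (conj_le_conj u hek).trans_eq (conj_inv_mul u),
    mk_eq_mk.2 (dRel_conj e.2 hek).symm⟩

theorem iicCard_add (x y : IdempotentClasses T) : iicCard (x + y) = iicCard x * iicCard y := by
  obtain ⟨e, f, g, hef, hg, hx, hy, hz⟩ := isClassSum_add x y
  rw [hz, hx, hy]
  exact natCard_Iic_join e.2 f.2 ((orthogonal_idem e.2 f.2).1 hef) hg

/-- `iicCard` is a homomorphism from addition to multiplication; this formula is what separates the
multiples of a class. -/
theorem iicCard_nsmul (n : ℕ) (x : IdempotentClasses T) :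
    iicCard (n • x) = iicCard x ^ n := by
  induction n with
  | zero => rw [zero_nsmul, iicCard_zero, pow_zero]
  | succ n ih => rw [succ_nsmul, iicCard_add, ih, pow_succ]

end IdempotentClasses

/-! ### Rook matrices with a single entry -/

namespace RookMatrix

variable {ι S : Type*} [InverseSemigroupWithZero S] [DecidableEq ι]

/-- The rook matrix with the single entry `a` at position `(i, j)`. -/
def single (i j : ι) (a : S) : RookMatrix ι S where
  entry k l := if k = i ∧ l = j then a else 0
  row k l l' h := by
    by_cases h1 : k = i ∧ l = j
    · rw [if_neg (c := k = i ∧ l' = j) fun h2 => h (h1.2.trans h2.2.symm), mul_zero]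
    · rw [if_neg h1, inv_zero_eq, zero_mul]
  col k k' l h := by
    by_cases h1 : k = i ∧ l = j
    · rw [if_neg (c := k' = i ∧ l = j) fun h2 => h (h1.1.trans h2.1.symm), inv_zero_eq, mul_zero]
    · rw [if_neg h1, zero_mul]
  finite := by
    refine (Set.finite_singleton (i, j)).subset ?_
    rintro ⟨k, l⟩ h
    by_contra h1
    exact h (if_neg fun h2 => h1 (Prod.ext h2.1 h2.2))

theorem single_entry (i j k l : ι) (a : S) :
    (single i j a).entry k l = if k = i ∧ l = j then a else 0 := rfl

theorem single_entry_same (i j : ι) (a : S) : (single i j a).entry i j = a :=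
  if_pos ⟨rfl, rfl⟩

theorem single_entry_ne {i j k l : ι} (a : S) (h : ¬(k = i ∧ l = j)) :
    (single i j a).entry k l = 0 := if_neg h

theorem single_inv (i j : ι) (a : S) : (single i j a)⁻¹ = single j i a⁻¹ := by
  ext k l
  rw [inv_entry, single_entry, single_entry]
  by_cases h : k = j ∧ l = i
  · rw [if_pos h, if_pos h.symm]
  · rw [if_neg h, if_neg fun h' => h h'.symm, inv_zero_eq]

theorem single_zero (i j : ι) : single i j (0 : S) = 0 := by
  ext k l
  rw [single_entry, ite_self, zero_entry]

theorem single_injective (i j : ι) : Function.Injective (single i j : S → RookMatrix ι S) :=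
  fun a b h => by rw [← single_entry_same i j a, h, single_entry_same]

variable [BooleanInverseSemigroup S]

theorem single_mul_single (i j k : ι) (a b : S) :
    single i j a * single j k b = single i k (a * b) := by
  ext l m
  have h := isLUB_range_single (f := fun n => (single i j a).entry l n * (single j k b).entry n m) j
    fun n hn => by rw [single_entry_ne a fun h => hn h.2, zero_mul]
  rw [mul_entry_eq h]
  simp only [single_entry]
  by_cases hl : l = i <;> by_cases hm : m = k <;> simp [hl, hm]

theorem isIdempotentElem_single (i : ι) {e : S} (he : IsIdempotentElem e) :
    IsIdempotentElem (single i i e) := by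
  rw [IsIdempotentElem, single_mul_single, he.eq]

theorem single_mul_mul_single (i : ι) (a b : S) (X : RookMatrix ι S) :
    single i i a * X * single i i b = single i i (a * X.entry i i * b) := by
  have h : ∀ (c : S) (j k : ι), j ≠ k → (single i i c).entry j k = 0 := fun c j k hjk =>
    single_entry_ne c fun h => hjk (h.1.trans h.2.symm)
  ext k l
  rw [mul_diag_entry (h b), diag_mul_entry (h a)]
  simp only [single_entry]
  by_cases hk : k = i <;> by_cases hl : l = i <;> simp [hk, hl]

/-- The order is entrywise, so every other entry lies below `0`. -/
theorem single_eq_of_le {i : ι} {a : S} {X : RookMatrix ι S} (h : X ≤ single i i a) :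
    X = single i i (X.entry i i) := by
  ext k l
  by_cases hkl : k = i ∧ l = i
  · obtain ⟨rfl, rfl⟩ := hkl
    rw [single_entry_same]
  · have := le_iff.1 h k l
    rw [single_entry_ne _ hkl] at this ⊢
    exact le_zero_eq this

theorem single_le_single {i j : ι} {a b : S} : single i j a ≤ single i j b ↔ a ≤ b := by
  rw [le_iff]
  constructor
  · intro h
    simpa only [single_entry_same] using h i j
  · intro h k l
    by_cases hkl : k = i ∧ l = j
    · rwa [single_entry, single_entry, if_pos hkl, if_pos hkl]
    · rw [single_entry_ne _ hkl, single_entry_ne _ hkl]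

theorem isLUB_single {i j : ι} {a b c : S} (h : IsLUB {a, b} c) :
    IsLUB {single i j a, single i j b} (single i j c) := by
  refine isLUB_of_entries fun k l => ?_
  by_cases hkl : k = i ∧ l = j
  · simpa only [single_entry, if_pos hkl] using h
  · simp only [single_entry, if_neg hkl]
    exact isLUB_insert_zero.2 isLUB_singleton

theorem dRel_single_single (i j : ι) {e : S} (he : IsIdempotentElem e) :
    DRel (single i i e) (single j j e) := by
  refine (dRel_idem (isIdempotentElem_single i he) (isIdempotentElem_single j he)).2
    ⟨single j i e, ?_, ?_⟩ <;> rw [single_inv, single_mul_single, inv_of_idem he, he.eq]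

/-- Passing to matrices creates no new `𝒟`-relations in `S`: a matrix whose domain and range are
both supported at `(i, i)` is itself supported there. -/
theorem dRel_single_iff {i : ι} {e f : S} (he : IsIdempotentElem e) (hf : IsIdempotentElem f) :
    DRel (single i i e) (single i i f) ↔ DRel e f := by
  rw [dRel_idem he hf, dRel_idem (isIdempotentElem_single i he) (isIdempotentElem_single i hf)]
  constructor
  · rintro ⟨X, hX, hX'⟩
    -- Sandwiching `X` as `(X * X⁻¹) * X * (X⁻¹ * X)` cuts it down to the corner.
    have h : X = single i i (f * X.entry i i * e) := by
      rw [← single_mul_mul_single, ← hX, ← hX', mul_inv_mul_self, mim]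
    rw [h, single_inv, single_mul_single] at hX hX'
    exact ⟨_, single_injective i i hX, single_injective i i hX'⟩
  · rintro ⟨x, hx, hx'⟩
    exact ⟨single i i x, by rw [single_inv, single_mul_single, hx],
      by rw [single_inv, single_mul_single, hx']⟩

end RookMatrix

/-! ### Generators of the type monoid -/

namespace TypeMonoid

open RookMatrix IdempotentClasses

variable {S : Type*} [InverseSemigroupWithZero S] [BooleanInverseSemigroup S]

/-- The class in the type monoid of an idempotent of `S`. -/
noncomputable def ofIdem (e : S) (he : IsIdempotentElem e) : TypeMonoid S :=
  IdempotentClasses.mk (single 0 0 e) (isIdempotentElem_single 0 he)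

theorem ofIdem_eq_ofIdem {e f : S} {he : IsIdempotentElem e} {hf : IsIdempotentElem f} :
    ofIdem e he = ofIdem f hf ↔ DRel e f :=
  mk_eq_mk.trans (dRel_single_iff he hf)

theorem ofIdem_eq_zero {e : S} {he : IsIdempotentElem e} : ofIdem e he = 0 ↔ e = 0 :=
  mk_eq_zero.trans ⟨fun h => single_injective 0 0 (h.trans (single_zero 0 0).symm),
    fun h => by rw [h, single_zero]⟩

theorem ofIdem_join {e f g : S} (he : IsIdempotentElem e) (hf : IsIdempotentElem f)
    (hg : IsIdempotentElem g) (hef : e * f = 0) (h : IsLUB {e, f} g) :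
    ofIdem g hg = ofIdem e he + ofIdem f hf :=
  mk_join _ _ _ (by rw [single_mul_single, hef, single_zero]) (isLUB_single h)

/-- The matrix idempotent that represents the summand lies below a single-entry matrix, hence comes
from `S`. -/
theorem exists_le_of_ofIdem_eq_add {g : S} {hg : IsIdempotentElem g} {x y : TypeMonoid S}
    (h : ofIdem g hg = x + y) : ∃ e he, e ≤ g ∧ ofIdem e he = x := by
  obtain ⟨E, hE, hEg, rfl⟩ := exists_le_of_mk_eq_add h
  have h1 := single_eq_of_le hEg
  have h2 : E.entry 0 0 ≤ g := by
    rw [h1] at hEg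
    exact single_le_single.1 hEg
  refine ⟨E.entry 0 0, idem_of_le hg h2, h2, ?_⟩
  simp only [ofIdem, ← h1]

/-- Every element of the type monoid is a sum of classes of idempotents of `S`. -/
theorem mem_of_forall_ofIdem_mem (M : AddSubmonoid (TypeMonoid S))
    (hM : ∀ (e : S) (he : IsIdempotentElem e), ofIdem e he ∈ M) (x : TypeMonoid S) : x ∈ M := by
  obtain ⟨E, hE, rfl⟩ := exists_rep x
  -- Induction on the number of non-zero diagonal entries, removing one at each step.
  induction hn : (E.finite_diag.toFinset).card generalizing E with
  | zero =>
    have h0 : E = 0 := by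
      ext i j
      by_cases hij : i = j
      · subst hij
        by_contra h
        have : i ∈ E.finite_diag.toFinset := by simpa using h
        rw [Finset.card_eq_zero.1 hn] at this
        exact absurd this (Finset.notMem_empty i)
      · exact (RookMatrix.isIdempotentElem_iff.1 hE).1 i j hij
    rw [mk_eq_zero.2 h0]
    exact M.zero_mem
  | succ n ih =>
    obtain ⟨hE1, hE2⟩ := RookMatrix.isIdempotentElem_iff.1 hE
    obtain ⟨i, hi⟩ : (E.finite_diag.toFinset).Nonempty := Finset.card_pos.1 (by omega)
    obtain ⟨F, hF1, hF2⟩ := exists_diag (fun k => if k = i then 0 else E.entry k k)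
      (E.finite_diag.subset fun k hk h => hk (by simp only [h, ite_self]))
    have hF : IsIdempotentElem F := RookMatrix.isIdempotentElem_iff.2 ⟨hF2, fun k => by
      rw [hF1]
      split_ifs
      · simp [IsIdempotentElem]
      · exact hE2 k⟩
    have hFn : F.finite_diag.toFinset.card = n := by
      have : F.finite_diag.toFinset = E.finite_diag.toFinset.erase i := by
        ext k
        simp [hF1]
      rw [this, Finset.card_erase_of_mem hi, hn, Nat.add_sub_cancel]
    have hs := isIdempotentElem_single i (hE2 i)
    have hjoin : IdempotentClasses.mk E hE =
        IdempotentClasses.mk (single i i (E.entry i i)) hs + IdempotentClasses.mk F hF := by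
      refine mk_join _ _ _ ?_ (isLUB_of_entries fun k l => ?_)
      · ext k l
        rw [mul_diag_entry hF2, hF1, single_entry]
        by_cases hl : l = i <;> simp [hl]
      · by_cases hkl : k = l
        · subst hkl
          rw [hF1, single_entry]
          by_cases hk : k = i
          · subst hk
            simp only [and_self, if_true]
            rw [Set.pair_comm, isLUB_insert_zero]
            exact isLUB_singleton
          · simp only [hk, and_self, if_false]
            rw [isLUB_insert_zero]
            exact isLUB_singleton
        · rw [hE1 k l hkl, hF2 k l hkl, single_entry_ne _ fun h => hkl (h.1.trans h.2.symm),
            isLUB_insert_zero]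
          exact isLUB_singleton
    rw [hjoin]
    refine M.add_mem ?_ (ih F hF hFn)
    -- The removed entry sits at `(i, i)`; up to `𝒟` it may be moved to `(0, 0)`, where `ofIdem`
    -- places it.
    rw [mk_eq_mk.2 (dRel_single_single i 0 (hE2 i))]
    exact hM _ (hE2 i)

theorem exists_complement {e f : S} (he : IsIdempotentElem e) (hf : IsIdempotentElem f)
    (hef : e ≤ f) : ∃ g hg, e * g = 0 ∧ IsLUB {e, g} f ∧
      ofIdem f hf = ofIdem e he + ofIdem g hg := by
  obtain ⟨g, hg, heg, h⟩ := exists_relative_complement e f he hf hef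
  exact ⟨g, hg, heg, h, ofIdem_join he hg hf heg h⟩

/-! ### From `0`-simplifying and semisimple to `ℕ` -/

/-- In a semisimple `0`-simplifying semigroup every class of an idempotent is a multiple of that
of a minimal one. -/
theorem ofIdem_mem_multiples (hS : IsZeroSimplifying S) (hss : IsSemisimpleInverse S) {p : S}
    (hp : IsMinimalIdempotent p) (e : S) (he : IsIdempotentElem e) :
    ofIdem e he ∈ AddSubmonoid.multiples (ofIdem p hp.idem) := by
  induction hn : (Set.Iic e).ncard using Nat.strong_induction_on generalizing e with
  | _ n ih =>
    by_cases h0 : e = 0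
    · rw [ofIdem_eq_zero.2 h0]
      exact zero_mem _
    · obtain ⟨q, hqe, hq⟩ := exists_isMinimalIdempotent_le hss he h0
      obtain ⟨g, hg, hqg, hlub, hadd⟩ := exists_complement hq.idem he hqe
      have hge : g ≤ e := hlub.1 (by simp)
      -- The complement `g` of `q` has strictly fewer elements below it than `e`: `q` itself is
      -- lost, because `q * g = 0` and `q ≠ 0`.
      have hlt : (Set.Iic g).ncard < n := by
        rw [← hn]
        refine Set.ncard_lt_ncard ⟨Set.Iic_subset_Iic.2 hge, fun h => hq.ne_zero ?_⟩ (hss e)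
        rw [← mul_eq_of_le_idem hg (h hqe), hqg]
      rw [hadd, ofIdem_eq_ofIdem (hf := hp.idem) |>.2 (dRel_of_isMinimalIdempotent hS hp hq)]
      exact add_mem (AddSubmonoid.mem_multiples _) (ih _ hlt g hg rfl)

/-- The isomorphism is the inverse of `n ↦ n • [p]`. It is onto because `[p]` generates, and
one-to-one because `n • [p]` has counting invariant `2 ^ n`. -/
theorem nonempty_addEquiv_nat (hS : IsZeroSimplifying S) (hss : IsSemisimpleInverse S) :
    Nonempty (TypeMonoid S ≃+ ℕ) := by
  obtain ⟨a, ha⟩ := @exists_ne S hS.1 0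
  obtain ⟨p, -, hp⟩ := exists_isMinimalIdempotent_le hss (idem_inv_mul a)
    fun h => ha (eq_zero_of_inv_mul h)
  have hcard : iicCard (ofIdem p hp.idem) = 2 := by
    -- The invariant counts elements below the representative in `OmegaRook S`, so minimality has to
    -- be carried over from `S`.
    have h : IsMinimalIdempotent (single 0 0 p : OmegaRook S) := by
      refine ⟨isIdempotentElem_single 0 hp.idem,
        fun h => hp.ne_zero (single_injective 0 0 (h.trans (single_zero 0 0).symm)),
        fun X hX => ?_⟩
      have h1 := single_eq_of_le hX
      rw [h1] at hX ⊢
      rcases hp.eq_or_eq _ (single_le_single.1 hX) with h2 | h2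
      · left; rw [h2, single_zero]
      · right; rw [h2]
    exact h.natCard_Iic
  refine ⟨(AddEquiv.ofBijective (multiplesHom (TypeMonoid S) (ofIdem p hp.idem))
    ⟨fun m n hmn => ?_, fun x => ?_⟩).symm⟩
  · simp only [multiplesHom_apply] at hmn
    have := congrArg iicCard hmn
    rw [iicCard_nsmul, iicCard_nsmul, hcard] at this
    exact Nat.pow_right_injective le_rfl this
  · exact mem_of_forall_ofIdem_mem (AddSubmonoid.multiples (ofIdem p hp.idem))
      (ofIdem_mem_multiples hS hss hp) x

/-! ### From `ℕ` to semisimple and `0`-simplifying -/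

theorem rank_pos (φ : TypeMonoid S ≃+ ℕ) {e : S} {he : IsIdempotentElem e} (h : e ≠ 0) : 0 < φ (ofIdem e he) := by
  rw [Nat.pos_iff_ne_zero, ne_eq, EmbeddingLike.map_eq_zero_iff, ofIdem_eq_zero]
  exact h

/-- Induction on rank: an idempotent with something strictly between `0` and itself splits into two
orthogonal non-zero pieces. Their ranks are positive with sum `n`, so both are smaller than `n`. -/
theorem finite_Iic_idem (φ : TypeMonoid S ≃+ ℕ) (e : S) (he : IsIdempotentElem e) : (Set.Iic e).Finite := by
  induction hn : φ (ofIdem e he) using Nat.strong_induction_on generalizing e with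
  | _ n ih =>
    by_cases hmin : ∀ x ≤ e, x = 0 ∨ x = e
    · exact (Set.toFinite {0, e}).subset fun x hx => hmin x hx
    · push Not at hmin
      obtain ⟨f, hfe, hf0, hne⟩ := hmin
      have hf := idem_of_le he hfe
      obtain ⟨g, hg, hfg, hlub, hadd⟩ := exists_complement hf he hfe
      have hg0 : g ≠ 0 := by
        rintro rfl
        rw [Set.pair_comm, isLUB_insert_zero] at hlub
        exact hne (isLUB_singleton.unique hlub)
      have h := congrArg φ hadd
      rw [map_add, hn] at h
      have h1 := rank_pos φ (he := hf) hf0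
      have h2 := rank_pos φ (he := hg) hg0
      have hfin := (ih _ (by omega) f hf rfl).prod (ih _ (by omega) g hg rfl)
      -- An element below `e` is the join of its restrictions to `f` and `g`, so this map is
      -- injective.
      refine Set.Finite.of_injOn (f := fun x => (x * f, x * g)) ?_ ?_ hfin
      · exact fun x hx => ⟨idem_mul_le f (idem_of_le he hx), idem_mul_le g (idem_of_le he hx)⟩
      · intro x hx y hy hxy
        have hx' := isLUB_mul_pair hf hg hlub hx
        have hxf : x * f = y * f := congrArg Prod.fst hxy
        have hxg : x * g = y * g := congrArg Prod.snd hxy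
        rw [hxf, hxg] at hx'
        exact hx'.unique (isLUB_mul_pair hf hg hlub hy)

theorem isSemisimpleInverse_of_addEquiv (φ : TypeMonoid S ≃+ ℕ) : IsSemisimpleInverse S := fun a =>
  finite_Iic_of_finite_Iic_inv_mul (finite_Iic_idem φ _ (idem_inv_mul a))

/-- Writing the rank as `1 + (n - 1)`, a genuine subtraction since the rank is positive, and pulling
back along `φ` exhibits a summand of rank `1`, which is realised below `e`. -/
theorem exists_le_rank_eq_one (φ : TypeMonoid S ≃+ ℕ) {e : S} (he : IsIdempotentElem e) (h0 : e ≠ 0) :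
    ∃ f hf, f ≤ e ∧ φ (ofIdem f hf) = 1 := by
  have h : ofIdem e he = φ.symm 1 + φ.symm (φ (ofIdem e he) - 1) := by
    apply φ.injective
    rw [map_add, φ.apply_symm_apply, φ.apply_symm_apply,
      Nat.add_sub_cancel' (rank_pos φ h0)]
  obtain ⟨f, hf, hfe, h1⟩ := exists_le_of_ofIdem_eq_add h
  exact ⟨f, hf, hfe, by rw [h1, φ.apply_symm_apply]⟩

theorem isZeroSimplifying_of_addEquiv (φ : TypeMonoid S ≃+ ℕ) : IsZeroSimplifying S := by
  refine ⟨?_, fun I hI => ?_⟩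
  · by_contra h
    rw [not_nontrivial_iff_subsingleton] at h
    -- If `S` were trivial, all generators of the type monoid would vanish, and so would the
    -- preimage of `1`.
    have h1 : φ.symm 1 ∈ (⊥ : AddSubmonoid (TypeMonoid S)) :=
      mem_of_forall_ofIdem_mem ⊥ (fun e he => ofIdem_eq_zero.2 (Subsingleton.elim e 0)) _
    rw [AddSubmonoid.mem_bot, EmbeddingLike.map_eq_zero_iff] at h1
    exact one_ne_zero h1
  · by_cases hI0 : I = {0}
    · exact Or.inl hI0
    · obtain ⟨a, haI, ha⟩ : ∃ a ∈ I, a ≠ 0 := by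
        by_contra! h
        exact hI0 (Set.eq_singleton_iff_unique_mem.2 ⟨hI.zero_mem, h⟩)
      obtain ⟨p, hp, hpa, hp1⟩ := exists_le_rank_eq_one φ (idem_inv_mul a)
        fun h => ha (eq_zero_of_inv_mul h)
      have hpI : p ∈ I := by
        rw [← mul_eq_of_le_idem (idem_inv_mul a) hpa]
        exact hI.mul_mem_left _ _ (hI.mul_mem_left _ _ haI)
      -- Induction on rank: `e` is the join of a rank-`1` idempotent `f` and a complement of smaller
      -- rank. Having equal ranks, `f` and `p` are `𝒟`-related.
      have key : ∀ (e : S) (he : IsIdempotentElem e), e ∈ I := by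
        intro e he
        induction hn : φ (ofIdem e he) using Nat.strong_induction_on generalizing e with
        | _ n ih =>
          by_cases h0 : e = 0
          · rw [h0]
            exact hI.zero_mem
          · obtain ⟨f, hf, hfe, hf1⟩ := exists_le_rank_eq_one φ he h0
            obtain ⟨g, hg, -, hlub, hadd⟩ := exists_complement hf he hfe
            have h := congrArg φ hadd
            rw [map_add, hn, hf1] at h
            have hgI := ih _ (by omega) g hg rfl
            obtain ⟨x, hx, hx'⟩ := (dRel_idem hp hf).1
              (ofIdem_eq_ofIdem.1 (φ.injective (hp1.trans hf1.symm)))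
            have hfI : f ∈ I := by
              -- This rewrites `f` as `x * p * x⁻¹`, a two-sided multiple of `p`.
              rw [← hx', ← conj_inv_mul, hx]
              exact hI.mul_mem_right _ _ (hI.mul_mem_left _ _ hpI)
            exact hI.join_mem f g e hfI hgI (Compatible.of_idem hf hg) hlub
      refine Or.inr (Set.eq_univ_of_forall fun b => ?_)
      rw [← mim b]
      exact hI.mul_mem_left _ _ (key _ (idem_inv_mul b))

end TypeMonoid

/-- The type monoid of a Boolean inverse semigroup `S` is isomorphic to `(ℕ, +)` if and only if `S`
is `0`-simplifying and semisimple. -/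
theorem theorem6p8 (S : Type*) [InverseSemigroupWithZero S] [BooleanInverseSemigroup S] :
    Nonempty (TypeMonoid S ≃+ ℕ) ↔ IsZeroSimplifying S ∧ IsSemisimpleInverse S := by
  exact ⟨fun ⟨φ⟩ => ⟨TypeMonoid.isZeroSimplifying_of_addEquiv φ,
    TypeMonoid.isSemisimpleInverse_of_addEquiv φ⟩,
    fun ⟨h1, h2⟩ => TypeMonoid.nonempty_addEquiv_nat h1 h2⟩
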